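/- Consider the Cramér–Lundberg surplus process $X_t = x + pt - \sum_{i=1}^{N_t} U_i$ with premium rate $p>0$, where $(N_t)$ is a Poisson process with intensity $\beta>0$, the claim sizes $U_i\ge 0$ are i.i.d. with continuous distribution function $F$, independent of $(N_t)$, and $p>\beta\,\mathbb{E}[U_1]$ (in particular $\mathbb{E}[U_1]<\infty$). Let $(\mathcal{F}_t)_{t\ge 0}$ be the filtration generated by $X$, completed by the null sets of a complete probability space. Let $q>0$ be a discount rate and $\overline{c}>0$ a maximal dividend rate. For $c\in[0,\overline{c}]$, an admissible ratcheting strategy is a càdlàg, $(\mathcal{F}_t)$-adapted, non-decreasing process $C=(C_t)_{t\ge 0}$ with $c\le C_t\le\overline{c}$ for all $t$. For $x\ge 0$, put $X_t^C = X_t-\int_0^t C_s\,ds$, $\tau=\inf\{t\ge 0: X_t^C<0\}$ (with $\inf\emptyset=\infty$), $J(x;C)=\mathbb{E}\left[\int_0^\tau e^{-qs}C_s\,ds\right]$, and let $$V(x,c)=\sup_C J(x;C),$$ the supremum being over all admissible strategies $C$ with initial minimum rate $c$. Assume that $F$ is Lipschitz: there is $K>0$ with $0\le F(y)-F(x)\le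 K(y-x)$ for all $x<y$. Then there exists a constant $K_1>0$ such that $$0\le V(x_2,c_1)-V(x_1,c_2)\le K_1\left[(x_2-x_1)+(c_2-c_1)\right]$$ for all $0\le x_1\le x_2$ and $0\le c_1\le c_2\le\min\{\overline{c},p\}$. In particular, $V$ is globally Lipschitz on $[0,\infty)\times[0,\min\{\overline{c},p\}]$. -/

import Mathlib

open MeasureTheory ProbabilityTheory Set Filter Topology
open scoped NNReal ENNReal

/-- The data of the Cramér–Lundberg model on a probability space `(Ω, P)`: premium rate, claim
intensity, claim size law, i.i.d. exponential waiting times between claims (so that the number of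
claims is a Poisson process) and i.i.d. claim sizes, the two families being independent of each
other, together with the safety loading condition. Claims are indexed from `0`. -/
structure CramerLundberg {Ω : Type*} [MeasurableSpace Ω] (P : Measure Ω) where
  /-- the premium rate `p` -/
  premium : ℝ
  premium_pos : 0 < premium
  /-- the claim intensity `β` -/
  intensity : ℝ
  intensity_pos : 0 < intensity
  /-- the law of a claim size, with distribution function `F = cdf claimLaw` -/
  claimLaw : Measure ℝ
  claimLaw_isProbability : IsProbabilityMeasure claimLaw
  /-- claim sizes are non-negative -/
  claimLaw_neg : claimLaw (Iio 0) = 0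
  /-- the claim size distribution function is continuous -/
  continuous_cdf : Continuous (cdf claimLaw)
  integrable_claim : Integrable (fun u : ℝ => u) claimLaw
  /-- safety loading -/
  safety_loading : intensity * ∫ u, u ∂claimLaw < premium
  /-- the waiting time for claim `n`, counted from claim `n - 1` (or from time `0` if `n = 0`) -/
  wait : ℕ → Ω → ℝ
  measurable_wait : ∀ n, Measurable (wait n)
  hasLaw_wait : ∀ n, HasLaw (wait n) (expMeasure intensity) P
  iIndepFun_wait : iIndepFun wait P
  /-- the size of claim `n` -/
  claim : ℕ → Ω → ℝ
  measurable_claim : ∀ n, Measurable (claim n)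
  hasLaw_claim : ∀ n, HasLaw (claim n) claimLaw P
  iIndepFun_claim : iIndepFun claim P
  indepFun_wait_claim : IndepFun (fun ω n => wait n ω) (fun ω n => claim n ω) P

namespace CramerLundberg

variable {Ω : Type*} [MeasurableSpace Ω] {P : Measure Ω} (M : CramerLundberg P)

/-- The arrival time of claim `n`. -/
def arrival (n : ℕ) (ω : Ω) : ℝ := ∑ i ∈ Finset.range (n + 1), M.wait i ω

/-- The number `N_t` of claims up to time `t`. -/
noncomputable def claimCount (t : ℝ≥0) (ω : Ω) : ℕ := {n : ℕ | M.arrival n ω ≤ t}.ncard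

/-- The free surplus `X_t = x + p t - ∑_{i ≤ N_t} U_i`. -/
noncomputable def freeSurplus (x : ℝ) (t : ℝ≥0) (ω : Ω) : ℝ :=
  x + M.premium * t - ∑ i ∈ Finset.range (M.claimCount t ω), M.claim i ω

lemma measurable_arrival (n : ℕ) : Measurable (M.arrival n) :=
  Finset.measurable_fun_sum _ fun i _ => M.measurable_wait i

lemma measurable_claimCount (t : ℝ≥0) : Measurable (M.claimCount t) := by
  have hn : ∀ n : ℕ, MeasurableSet {ω | M.arrival n ω ≤ t} := fun n =>
    measurableSet_le (M.measurable_arrival n) measurable_const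
  have hF : ∀ F : Finset ℕ, MeasurableSet {ω | {n : ℕ | M.arrival n ω ≤ t} = (F : Set ℕ)} := by
    intro F
    have : {ω | {n : ℕ | M.arrival n ω ≤ t} = (F : Set ℕ)}
        = ⋂ n : ℕ, {ω | M.arrival n ω ≤ t ↔ n ∈ F} := by
      ext ω
      simp [Set.ext_iff]
    rw [this]
    refine MeasurableSet.iInter fun n => ?_
    by_cases h : n ∈ F
    · simpa [h] using hn n
    · simpa [h] using (measurableSet_lt measurable_const (M.measurable_arrival n))
  have hk : ∀ k : ℕ, 0 < k → MeasurableSet (M.claimCount t ⁻¹' {k}) := by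
    intro k hk
    have : M.claimCount t ⁻¹' {k}
        = ⋃ F ∈ {F : Finset ℕ | F.card = k},
          {ω | {n : ℕ | M.arrival n ω ≤ t} = (F : Set ℕ)} := by
      ext ω
      simp only [mem_preimage, mem_singleton_iff, claimCount, mem_iUnion, mem_ofPred_eq,
        exists_prop]
      constructor
      · intro h
        have hfin := Set.finite_of_ncard_pos (h ▸ hk)
        exact ⟨hfin.toFinset, by rw [← h, Set.ncard_eq_toFinset_card _ hfin], by simp⟩
      · rintro ⟨F, h, h'⟩
        rw [h', Set.ncard_coe_finset, h]
    rw [this]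
    exact MeasurableSet.biUnion (Set.to_countable _) fun F _ => hF F
  refine measurable_to_countable' fun k => ?_
  rcases Nat.eq_zero_or_pos k with rfl | h
  · have : M.claimCount t ⁻¹' {0} = (⋃ k : ℕ, M.claimCount t ⁻¹' {k + 1})ᶜ := by
      ext ω
      simp only [mem_preimage, mem_singleton_iff, mem_compl_iff, mem_iUnion]
      constructor
      · rintro h ⟨k, hk⟩
        omega
      · intro h
        by_contra h0
        exact h ⟨M.claimCount t ω - 1, by omega⟩
    rw [this]
    exact (MeasurableSet.iUnion fun k => hk _ k.succ_pos).compl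
  · exact hk k h

lemma measurable_freeSurplus (x : ℝ) (t : ℝ≥0) : Measurable (M.freeSurplus x t) := by
  have h : Measurable fun z : ℕ × Ω => ∑ i ∈ Finset.range z.1, M.claim i z.2 :=
    measurable_from_prod_countable_right fun k => by
      simpa using Finset.measurable_fun_sum (Finset.range k) fun i _ => M.measurable_claim i
  exact measurable_const.sub (h.comp ((M.measurable_claimCount t).prodMk measurable_id))

/-- The filtration generated by the surplus process, completed by the null sets of `P`. Changing
the initial surplus shifts the process by a constant and does not change the filtration. -/
noncomputable def filtration [P.IsComplete] : Filtration ℝ≥0 ‹MeasurableSpace Ω› where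
  seq t := (⨆ s ≤ t, MeasurableSpace.comap (M.freeSurplus 0 s) inferInstance) ⊔
    MeasurableSpace.generateFrom {A | P A = 0}
  mono' _ _ hst := sup_le_sup_right (biSup_mono fun _ h => h.trans hst) _
  le' _ := sup_le (iSup₂_le fun s _ => (M.measurable_freeSurplus 0 s).comap_le)
    (MeasurableSpace.generateFrom_le fun A hA => Measure.IsComplete.out' A hA)

/-- `C` is an admissible dividend ratcheting strategy with rates between `c` and `cbar`: it is
adapted, càdlàg, non-decreasing in time and satisfies `c ≤ C_t ≤ cbar`. -/
structure IsAdmissible [P.IsComplete] (cbar c : ℝ) (C : ℝ≥0 → Ω → ℝ) : Prop where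
  adapted : Adapted M.filtration C
  right_continuous : ∀ ω t, ContinuousWithinAt (fun s => C s ω) (Ici t) t
  left_limit : ∀ ω t, ∃ l, Tendsto (fun s => C s ω) (𝓝[<] t) (𝓝 l)
  monotone : ∀ ω, Monotone fun t => C t ω
  lower : ∀ t ω, c ≤ C t ω
  upper : ∀ t ω, C t ω ≤ cbar

/-- The controlled surplus `X_t^C = X_t - ∫_0^t C_s ds`. -/
noncomputable def controlledSurplus (x : ℝ) (C : ℝ≥0 → Ω → ℝ) (t : ℝ≥0) (ω : Ω) : ℝ :=
  M.freeSurplus x t ω - ∫ s in (0 : ℝ)..t, C s.toNNReal ω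

/-- The ruin time `τ = inf {t ≥ 0 : X_t^C < 0}`, equal to `∞` if there is no ruin. -/
noncomputable def ruinTime (x : ℝ) (C : ℝ≥0 → Ω → ℝ) (ω : Ω) : ℝ≥0∞ :=
  sInf ((fun t : ℝ≥0 => (t : ℝ≥0∞)) '' {t | M.controlledSurplus x C t ω < 0})

/-- The value `J(x; C) = E[∫_0^τ e^{-qs} C_s ds]` of a strategy. -/
noncomputable def strategyValue (q x : ℝ) (C : ℝ≥0 → Ω → ℝ) : ℝ :=
  ∫ ω, (∫ s in {s : ℝ | 0 ≤ s ∧ ENNReal.ofReal s < M.ruinTime x C ω},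
    Real.exp (-q * s) * C s.toNNReal ω) ∂P

/-- The optimal value function `V(x, c) = sup_C J(x; C)`, over the admissible strategies. -/
noncomputable def value [P.IsComplete] (q cbar x c : ℝ) : ℝ :=
  sSup ((fun C => M.strategyValue q x C) '' {C | M.IsAdmissible cbar c C})

/-- For `0 ≤ c` the supremum defining the value function is over a set bounded above. -/
lemma bddAbove_strategyValue [P.IsComplete] [IsProbabilityMeasure P] {q cbar c : ℝ} (hq : 0 < q)
    (hc : 0 ≤ c) (x : ℝ) :
    BddAbove ((fun C => M.strategyValue q x C) '' {C | M.IsAdmissible cbar c C}) := by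
  refine ⟨∫ s in Ici (0 : ℝ), Real.exp (-q * s) * cbar, ?_⟩
  rintro _ ⟨C, (hC : M.IsAdmissible cbar c C), rfl⟩
  have hint : IntegrableOn (fun s : ℝ => Real.exp (-q * s) * cbar) (Ici 0) := by
    rw [integrableOn_Ici_iff_integrableOn_Ioi]
    exact (integrableOn_exp_mul_Ioi (by linarith) 0).mul_const _
  have key : ∀ ω, ‖∫ s in {s : ℝ | 0 ≤ s ∧ ENNReal.ofReal s < M.ruinTime x C ω},
      Real.exp (-q * s) * C s.toNNReal ω‖ ≤ ∫ s in Ici (0 : ℝ), Real.exp (-q * s) * cbar := by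
    intro ω
    have h0 : ∀ s : ℝ≥0, 0 ≤ C s ω := fun s => hc.trans (hC.lower s ω)
    have hcb : 0 ≤ cbar := (h0 0).trans (hC.upper 0 ω)
    refine (norm_integral_le_of_norm_le (hint.mono_set fun s hs => hs.1)
      (Eventually.of_forall fun s => ?_)).trans
      (setIntegral_mono_set hint (Eventually.of_forall fun s => by
        simp only [Pi.zero_apply]; positivity)
        (HasSubset.Subset.eventuallyLE fun s hs => hs.1))
    rw [Real.norm_of_nonneg (mul_nonneg (Real.exp_pos _).le (h0 _))]
    exact mul_le_mul_of_nonneg_left (hC.upper _ _) (Real.exp_pos _).le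
  refine (le_abs_self _).trans ?_
  simpa [strategyValue] using norm_integral_le_of_norm_le_const (μ := P) (Eventually.of_forall key)

/-- For `c ≤ cbar` the supremum defining the value function is over a non-empty set. -/
lemma nonempty_strategyValue [P.IsComplete] {q cbar c : ℝ} (hc : c ≤ cbar) (x : ℝ) :
    ((fun C => M.strategyValue q x C) '' {C | M.IsAdmissible cbar c C}).Nonempty :=
  ⟨_, fun _ _ => cbar, ⟨fun _ => measurable_const, fun _ _ => continuousWithinAt_const,
    fun _ _ => ⟨cbar, tendsto_const_nhds⟩, fun _ => monotone_const, fun _ _ => hc,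
    fun _ _ => le_rfl⟩, rfl⟩

end CramerLundberg

/-! The lower bound is monotonicity: a strategy with minimum rate `c₂` also has minimum rate `c₁ ≤
c₂`, and more initial surplus postpones ruin.

For the upper bound, put `h = x₂ - x₁ > 0`, let `C` be a strategy for `(x₂, c₁)`, and let `D` start
from `x₁` and pay `max c₂ (min C p)` for as long as the `C`-surplus is ahead of the `D`-surplus,
then copy `C`. The lead starts at `h` and can only shrink while `C > p ≥ c₂`, so the switch to `C`
is an upward jump at most and `D` is an admissible ratchet (`IsAdmissible.cappedStrategy`). Two
losses must be bounded.

Dividends: over any `[0, θ]` the total of `C - D` is at most `h`, and its sign changes only from `≤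
0` to `≥ 0`, so discounting keeps the bound `h` (`integral_exp_mul_sub_cappedRate_le`).

Earlier ruin: while `D` is behind, it pays at most `p`, so its surplus falls only at claims. If `D`
is ruined strictly before `C`, some claim `n` has a size in an interval `(Y, Y + h + (c₂ - c₁)
T_n]`, where `Y` is the `D`-surplus just before the claim (`IsAdmissible.exists_separatingClaim`).
Both `T_n` and `Y` are determined by data independent of that claim, so the Lipschitz bound on `F`
gives this conditional probability at most `K (h + (c₂ - c₁) T_n)`, and what is lost after `T_n` is
worth at most `(cbar / q) exp (-q T_n)`. Half of the discount absorbs the factor `T_n`; the other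
half makes the sum over `n` a convergent geometric series (`IsAdmissible.strategyValue_le`).

The case `x₁ = x₂` follows by letting the larger surplus decrease to its limit (`value_le_add`). -/

/-! ### Joint measurability, and discounting under a sign change -/

/-- A right-continuous process that is measurable at each time is jointly measurable. -/
lemma measurable_uncurry_of_continuousWithinAt_Ici {Ω : Type*} {m : MeasurableSpace Ω}
    {f : ℝ → Ω → ℝ} (hf : ∀ s, Measurable (f s))
    (hc : ∀ ω s, ContinuousWithinAt (fun s => f s ω) (Ici s) s) :
    Measurable fun z : ℝ × Ω => f z.1 z.2 := by
  -- Round `s` up to the next point of the grid of mesh `1 / (k + 1)`: the approximation comes from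
  -- the right and takes countably many values.
  have happrox : ∀ s : ℝ, Tendsto (fun k : ℕ => ((⌊s * (k + 1)⌋ : ℝ) + 1) / (k + 1)) atTop
      (𝓝[Ici s] s) := by
    intro s
    have hpos : ∀ k : ℕ, (0 : ℝ) < k + 1 := fun k => by positivity
    refine tendsto_nhdsWithin_iff.2 ⟨?_, Eventually.of_forall fun k => ?_⟩
    · refine tendsto_of_tendsto_of_tendsto_of_le_of_le (tendsto_const_nhds (x := s))
        (h := fun k : ℕ => s + 1 / ((k : ℝ) + 1)) ?_ (fun k => ?_) (fun k => ?_)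
      · simpa using (tendsto_const_nhds (x := s)).add
          (tendsto_one_div_add_atTop_nhds_zero_nat (𝕜 := ℝ))
      · simp only
        rw [le_div_iff₀ (hpos k)]
        exact (Int.lt_floor_add_one _).le
      · simp only
        rw [div_le_iff₀ (hpos k), add_mul, one_div, inv_mul_cancel₀ (hpos k).ne']
        gcongr
        exact Int.floor_le _
    · rw [mem_Ici, le_div_iff₀ (hpos k)]
      exact (Int.lt_floor_add_one _).le
  refine measurable_of_tendsto_metrizable
    (f := fun (k : ℕ) (z : ℝ × Ω) => f (((⌊z.1 * (k + 1)⌋ : ℝ) + 1) / (k + 1)) z.2)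
    (fun k => ?_) (tendsto_pi_nhds.2 fun z => (hc z.2 z.1).tendsto.comp (happrox z.1))
  have h : Measurable fun z : ℤ × Ω => f (((z.1 : ℝ) + 1) / (k + 1)) z.2 :=
    measurable_from_prod_countable_right fun j => hf (((j : ℝ) + 1) / (k + 1))
  have h2 : Measurable fun z : ℝ × Ω => ⌊z.1 * ((k : ℝ) + 1)⌋ :=
    Int.measurable_floor.comp (measurable_fst.mul_const _)
  exact h.comp (h2.prodMk measurable_snd)

/-- If `f` integrates to at most `h` over each `[0, θ]` and is at first non-positive, then
non-negative, then its discounted integrals are at most `h` as well. -/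
lemma integral_exp_mul_le_of_sign_change {f : ℝ → ℝ} {q h θ : ℝ} (hq : 0 ≤ q) (hθ : 0 ≤ θ)
    (hf : IntervalIntegrable f volume 0 θ) (hh : 0 ≤ h) (hle : ∫ s in 0..θ, f s ≤ h)
    (hsign : ∀ s t, 0 ≤ s → s ≤ t → 0 < f s → 0 ≤ f t) :
    ∫ s in 0..θ, Real.exp (-q * s) * f s ≤ h := by
  have hcont : Continuous fun s : ℝ => Real.exp (-q * s) := by fun_prop
  have hint := hf.continuousOn_mul hcont.continuousOn
  by_cases hS : ∃ s, 0 ≤ s ∧ 0 < f s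
  -- Freeze the weight at the sign change `a`: before `a` the true weight is larger but `f ≤ 0`,
  -- after `a` it is smaller but `f ≥ 0`. The sign at `a` itself is unknown, hence the
  -- almost-everywhere comparison.
  · set a := sInf {s | 0 ≤ s ∧ 0 < f s}
    have hbdd : BddBelow {s | 0 ≤ s ∧ 0 < f s} := ⟨0, fun s hs => hs.1⟩
    have ha0 : 0 ≤ a := le_csInf hS fun s hs => hs.1
    have key : ∀ s ∈ Ioo 0 θ, s ≠ a →
        Real.exp (-q * s) * f s ≤ Real.exp (-q * a) * f s := by
      intro s hs hsa
      rcases lt_or_gt_of_ne hsa with hlt | hgt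
      · have : f s ≤ 0 := by
          by_contra hcon
          exact absurd (csInf_le hbdd ⟨hs.1.le, not_le.1 hcon⟩) (not_le.2 hlt)
        refine mul_le_mul_of_nonpos_right (Real.exp_le_exp.2 ?_) this
        nlinarith
      · obtain ⟨u, hu, hus⟩ := exists_lt_of_csInf_lt hS hgt
        have := hsign u s hu.1 hus.le hu.2
        refine mul_le_mul_of_nonneg_right (Real.exp_le_exp.2 ?_) this
        nlinarith
    have hmono : ∫ s in 0..θ, Real.exp (-q * s) * f s
        ≤ ∫ s in 0..θ, Real.exp (-q * a) * f s := by
      rw [intervalIntegral.integral_of_le hθ, intervalIntegral.integral_of_le hθ,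
        integral_Ioc_eq_integral_Ioo, integral_Ioc_eq_integral_Ioo]
      have e := (intervalIntegrable_iff_integrableOn_Ioo_of_le hθ).1 hint
      have e' := (intervalIntegrable_iff_integrableOn_Ioo_of_le hθ).1 hf
      refine integral_mono_ae e (e'.const_mul _) ?_
      have h1 : ∀ᵐ s ∂(volume.restrict (Ioo 0 θ)), s ≠ a :=
        ae_restrict_of_ae (by simp [ae_iff])
      filter_upwards [h1, ae_restrict_mem measurableSet_Ioo] with s h1 h2 using key s h2 h1
    rw [intervalIntegral.integral_const_mul] at hmono
    have hexp : Real.exp (-q * a) ≤ 1 := Real.exp_le_one_iff.2 (by nlinarith)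
    calc _ ≤ _ := hmono
      _ ≤ Real.exp (-q * a) * h := mul_le_mul_of_nonneg_left hle (Real.exp_pos _).le
      _ ≤ 1 * h := mul_le_mul_of_nonneg_right hexp hh
      _ = h := one_mul h
  · push Not at hS
    refine le_trans ?_ hh
    rw [intervalIntegral.integral_of_le hθ]
    refine setIntegral_nonpos measurableSet_Ioc fun s hs => ?_
    exact mul_nonpos_of_nonneg_of_nonpos (Real.exp_pos _).le (hS s hs.1.le)

/-! ### The capped rate along a single path -/

/-- The advantage `h + ∫_0^t (max b (min c_s p) - c_s) ds` that a surplus paying dividends at rate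
`c` has left over one paying at rate `max b (min c p)`, starting from `h`. -/
noncomputable def rateGap (h b p : ℝ) (c : ℝ → ℝ) (t : ℝ) : ℝ :=
  h + ∫ s in 0..t, (max b (min (c s) p) - c s)

open Classical in
/-- The rate that is raised to `b` and capped at `p` until the advantage `rateGap` is used up, and
agrees with `c` from then on. -/
noncomputable def cappedRate (h b p : ℝ) (c : ℝ → ℝ) (t : ℝ) : ℝ :=
  if rateGap h b p c t ≤ 0 then c t else max b (min (c t) p)

section Rate

variable {h b p : ℝ} {c : ℝ → ℝ}

lemma Monotone.intervalIntegrable_capped (hc : Monotone c) (b p s t : ℝ) :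
    IntervalIntegrable (fun s => max b (min (c s) p) - c s) volume s t := by
  have h1 : Monotone fun s => max b (min (c s) p) := fun s t hst =>
    max_le_max le_rfl (min_le_min (hc hst) le_rfl)
  exact h1.intervalIntegrable.sub hc.intervalIntegrable

lemma continuous_rateGap (hc : Monotone c) : Continuous (rateGap h b p c) :=
  continuous_const.add
    (intervalIntegral.continuous_primitive (fun s t => hc.intervalIntegrable_capped b p s t) 0)

lemma rateGap_add (hc : Monotone c) (s t : ℝ) :
    rateGap h b p c t = rateGap h b p c s + ∫ u in s..t, (max b (min (c u) p) - c u) := by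
  rw [rateGap, rateGap, add_assoc, intervalIntegral.integral_add_adjacent_intervals
    (hc.intervalIntegrable_capped b p _ _) (hc.intervalIntegrable_capped b p _ _)]

/-- While `c ≤ p` the cap is inactive and the advantage cannot decrease. It is therefore exhausted
only after `c` has passed `p`, which is what makes the switch back to `c` compatible with
ratcheting. -/
lemma lt_of_rateGap_nonpos (hc : Monotone c) (hh : 0 < h) {t : ℝ} (ht : 0 ≤ t)
    (hg : rateGap h b p c t ≤ 0) : p < c t := by
  by_contra hcon
  have : 0 ≤ ∫ s in 0..t, (max b (min (c s) p) - c s) := by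
    refine intervalIntegral.integral_nonneg ht fun s hs => ?_
    have : c s ≤ p := (hc hs.2).trans (not_lt.1 hcon)
    simp [min_eq_left this]
  rw [rateGap] at hg
  linarith

lemma integral_capped_le (hbp : b ≤ p) (hc : Monotone c) {s t : ℝ} (hst : s ≤ t)
    (hps : p ≤ c s) : ∫ u in s..t, (max b (min (c u) p) - c u) ≤ (t - s) * (p - c s) := by
  have : ∫ u in s..t, (max b (min (c u) p) - c u) ≤ ∫ _u in s..t, (p - c s) := by
    refine intervalIntegral.integral_mono_on hst (hc.intervalIntegrable_capped b p _ _)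
      intervalIntegrable_const fun u hu => ?_
    have := hc hu.1
    rw [min_eq_right (hps.trans this), max_eq_right hbp]
    linarith
  rwa [intervalIntegral.integral_const, smul_eq_mul] at this

/-- Exhaustion forces `c > p`, and this persists by monotonicity, so the integrand stays negative:
there is a single switching time. -/
lemma rateGap_nonpos_of_le (hbp : b ≤ p) (hc : Monotone c) (hh : 0 < h) {s t : ℝ} (hs : 0 ≤ s)
    (hst : s ≤ t) (hg : rateGap h b p c s ≤ 0) : rateGap h b p c t ≤ 0 := by
  have h1 := lt_of_rateGap_nonpos hc hh hs hg
  have h2 := integral_capped_le hbp hc hst h1.le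
  rw [rateGap_add hc s t]
  nlinarith

lemma rateGap_neg_of_lt (hbp : b ≤ p) (hc : Monotone c) (hh : 0 < h) {s t : ℝ} (hs : 0 ≤ s)
    (hst : s < t) (hg : rateGap h b p c s ≤ 0) : rateGap h b p c t < 0 := by
  have h1 := lt_of_rateGap_nonpos hc hh hs hg
  have h2 := integral_capped_le hbp hc hst.le h1.le
  rw [rateGap_add hc s t]
  nlinarith [mul_pos (sub_pos.2 hst) (sub_pos.2 h1)]

/-- The advantage grows only when the rate is raised to `b`, which gains at most `b - a` per unit of
time; capping only reduces it. -/
lemma rateGap_le {a : ℝ} (hab : a ≤ b) (hc : Monotone c) (hac : ∀ s, a ≤ c s) {t : ℝ}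
    (ht : 0 ≤ t) : rateGap h b p c t ≤ h + (b - a) * t := by
  have : ∫ u in 0..t, (max b (min (c u) p) - c u) ≤ ∫ _ in 0..t, (b - a) := by
    refine intervalIntegral.integral_mono_on ht (hc.intervalIntegrable_capped b p _ _)
      intervalIntegrable_const fun u hu => ?_
    rcases max_choice b (min (c u) p) with hm | hm <;> rw [hm]
    · linarith [hac u]
    · linarith [min_le_left (c u) p]
  rw [rateGap]
  simp at this
  linarith

lemma cappedRate_of_nonpos {t : ℝ} (hg : rateGap h b p c t ≤ 0) : cappedRate h b p c t = c t :=
  if_pos hg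

lemma cappedRate_of_pos {t : ℝ} (hg : 0 < rateGap h b p c t) :
    cappedRate h b p c t = max b (min (c t) p) :=
  if_neg (not_le.2 hg)

lemma le_cappedRate (hbp : b ≤ p) (hc : Monotone c) (hh : 0 < h) {t : ℝ} (ht : 0 ≤ t) :
    b ≤ cappedRate h b p c t := by
  rcases le_or_gt (rateGap h b p c t) 0 with hg | hg
  · rw [cappedRate_of_nonpos hg]
    exact hbp.trans (lt_of_rateGap_nonpos hc hh ht hg).le
  · rw [cappedRate_of_pos hg]
    exact le_max_left _ _

lemma cappedRate_le {d : ℝ} (hbd : b ≤ d) (hcd : ∀ t, c t ≤ d) (t : ℝ) :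
    cappedRate h b p c t ≤ d := by
  rcases le_or_gt (rateGap h b p c t) 0 with hg | hg
  · rw [cappedRate_of_nonpos hg]
    exact hcd t
  · rw [cappedRate_of_pos hg]
    exact max_le hbd ((min_le_left _ _).trans (hcd t))

lemma cappedRate_le_of_pos (hbp : b ≤ p) {t : ℝ} (hg : 0 < rateGap h b p c t) :
    cappedRate h b p c t ≤ p := by
  rw [cappedRate_of_pos hg]
  exact max_le hbp (min_le_right _ _)

/-- Both branches are monotone, and at the switch `c` dominates both `b` and `min c p`. Negative
times are excluded because the sign argument for the advantage integrates forward from `0`. -/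
lemma cappedRate_monotoneOn (hbp : b ≤ p) (hc : Monotone c) (hh : 0 < h) :
    MonotoneOn (cappedRate h b p c) (Ici 0) := by
  intro s hs t ht hst
  rcases le_or_gt (rateGap h b p c s) 0 with hg | hg
  · rw [cappedRate_of_nonpos hg, cappedRate_of_nonpos (rateGap_nonpos_of_le hbp hc hh hs hst hg)]
    exact hc hst
  · rw [cappedRate_of_pos hg]
    rcases le_or_gt (rateGap h b p c t) 0 with hg' | hg'
    · rw [cappedRate_of_nonpos hg']
      exact max_le (hbp.trans (lt_of_rateGap_nonpos hc hh ht hg').le)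
        ((min_le_left _ _).trans (hc hst))
    · rw [cappedRate_of_pos hg']
      exact max_le_max le_rfl (min_le_min (hc hst) le_rfl)

lemma intervalIntegrable_cappedRate (hbp : b ≤ p) (hc : Monotone c) (hh : 0 < h) {s t : ℝ}
    (hs : 0 ≤ s) (ht : 0 ≤ t) : IntervalIntegrable (cappedRate h b p c) volume s t :=
  MonotoneOn.intervalIntegrable ((cappedRate_monotoneOn hbp hc hh).mono fun _ hu =>
    (le_min hs ht).trans hu.1)

/-- The advantage left over the surplus that pays at rate `cappedRate`. -/
lemma add_integral_cappedRate (hbp : b ≤ p) (hc : Monotone c) (hh : 0 < h) {t : ℝ} (ht : 0 ≤ t) :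
    h + ∫ s in 0..t, (cappedRate h b p c s - c s) = max (rateGap h b p c t) 0 := by
  have hpos : ∀ u, 0 ≤ u → 0 ≤ rateGap h b p c u →
      h + ∫ s in 0..u, (cappedRate h b p c s - c s) = rateGap h b p c u := by
    intro u hu hg
    conv_rhs => rw [rateGap]
    rw [intervalIntegral.integral_of_le hu, intervalIntegral.integral_of_le hu,
      integral_Ioc_eq_integral_Ioo, integral_Ioc_eq_integral_Ioo]
    congr 1
    refine setIntegral_congr_fun measurableSet_Ioo fun s hs => ?_
    rw [cappedRate_of_pos]
    by_contra hcon
    exact absurd (rateGap_neg_of_lt hbp hc hh hs.1.le hs.2 (not_lt.1 hcon)) (not_lt.2 hg)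
  rcases le_or_gt (rateGap h b p c t) 0 with hg | hg
  · rw [max_eq_right hg]
    have h0 : rateGap h b p c 0 = h := by simp [rateGap]
    -- `σ` is the moment of exhaustion; from then on the two rates coincide and the difference stays
    -- `0`.
    obtain ⟨σ, hσ, hσ0⟩ := intermediate_value_Icc' ht
      (continuous_rateGap (h := h) (b := b) (p := p) hc).continuousOn ⟨hg, by rw [h0]; exact hh.le⟩
    have h1 := hpos σ hσ.1 hσ0.ge
    have h2 : ∫ s in σ..t, (cappedRate h b p c s - c s) = 0 := by
      rw [intervalIntegral.integral_of_le hσ.2]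
      refine setIntegral_eq_zero_of_forall_eq_zero fun s hs => ?_
      rw [cappedRate_of_nonpos (rateGap_nonpos_of_le hbp hc hh hσ.1 hs.1.le hσ0.le), sub_self]
    rw [← intervalIntegral.integral_add_adjacent_intervals (b := σ)
      ((intervalIntegrable_cappedRate hbp hc hh le_rfl hσ.1).sub hc.intervalIntegrable)
      ((intervalIntegrable_cappedRate hbp hc hh hσ.1 ht).sub hc.intervalIntegrable), h2]
    linarith
  · rw [max_eq_left hg.le, hpos t ht hg.le]

/-- The discounted dividends lost by paying at rate `cappedRate` are at most `h`. -/
lemma integral_exp_mul_sub_cappedRate_le (hbp : b ≤ p) (hc : Monotone c) (hh : 0 < h) {q t : ℝ}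
    (hq : 0 ≤ q) (ht : 0 ≤ t) :
    ∫ s in 0..t, Real.exp (-q * s) * (c s - cappedRate h b p c s) ≤ h := by
  refine integral_exp_mul_le_of_sign_change hq ht
    (hc.intervalIntegrable.sub (intervalIntegrable_cappedRate hbp hc hh le_rfl ht)) hh.le ?_ ?_
  · have h1 := add_integral_cappedRate hbp hc hh ht
    have h2 : ∫ s in 0..t, (c s - cappedRate h b p c s)
        = - ∫ s in 0..t, (cappedRate h b p c s - c s) := by
      rw [← intervalIntegral.integral_neg]
      simp
    have h3 := le_max_right (rateGap h b p c t) 0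
    linarith
  · intro s t hs hst hpos
    -- Below `p` the modified rate is at least `c`. So a positive loss means `c ≥ p`, which
    -- persists, while the modified rate is afterwards at most `p` or equal to `c`.
    have hps : p ≤ c s := by
      by_contra hcon
      rcases le_or_gt (rateGap h b p c s) 0 with hg | hg
      · exact hcon (lt_of_rateGap_nonpos hc hh hs hg).le
      · rw [cappedRate_of_pos hg, min_eq_left (not_le.1 hcon).le] at hpos
        linarith [le_max_right b (c s)]
    have hpt := hps.trans (hc hst)
    rcases le_or_gt (rateGap h b p c t) 0 with hg | hg
    · rw [cappedRate_of_nonpos hg, sub_self]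
    · linarith [cappedRate_le_of_pos hbp hg]

/-- A positive advantage remains positive nearby and an exhausted one stays exhausted, so just to
the right of `t` a single branch is in force. -/
lemma continuousWithinAt_cappedRate (hbp : b ≤ p) (hc : Monotone c) (hh : 0 < h) {t : ℝ}
    (ht : 0 ≤ t) (hct : ContinuousWithinAt c (Ici t) t) :
    ContinuousWithinAt (cappedRate h b p c) (Ici t) t := by
  rcases le_or_gt (rateGap h b p c t) 0 with hg | hg
  · exact hct.congr (fun s hs => cappedRate_of_nonpos (rateGap_nonpos_of_le hbp hc hh ht hs hg))
      (cappedRate_of_nonpos hg)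
  · have h1 : ContinuousWithinAt (fun s => max b (min (c s) p)) (Ici t) t :=
      continuousWithinAt_const.max (hct.min continuousWithinAt_const)
    refine h1.congr_of_eventuallyEq ?_ (cappedRate_of_pos hg)
    have h2 : ∀ᶠ s in 𝓝 t, 0 < rateGap h b p c s :=
      (continuous_rateGap hc).continuousAt.eventually (lt_mem_nhds hg)
    filter_upwards [nhdsWithin_le_nhds h2] with s hs using cappedRate_of_pos hs

end Rate

/-! ### Claim arrivals: Laplace transforms and absence of accumulation -/

namespace CramerLundberg

variable {Ω : Type*} [MeasurableSpace Ω] {P : Measure Ω} (M : CramerLundberg P)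

/-- The scenarios in which waiting times are positive and claims do not accumulate. -/
def Regular (ω : Ω) : Prop :=
  (∀ n, 0 < M.wait n ω) ∧ Tendsto (fun n => M.arrival n ω) atTop atTop

lemma ae_wait_pos (n : ℕ) : ∀ᵐ ω ∂P, 0 < M.wait n ω := by
  have := isProbabilityMeasure_expMeasure M.intensity_pos
  have h0 : expMeasure M.intensity (Iic 0) = 0 := by
    have h1 : (expMeasure M.intensity).real (Iic 0) = 0 := by
      rw [← cdf_eq_real, cdf_expMeasure_eq M.intensity_pos]
      simp
    exact (measureReal_eq_zero_iff (measure_ne_top _ _)).1 h1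
  rw [(M.hasLaw_wait n).ae_iff (p := fun x : ℝ => 0 < x) measurableSet_Ioi.mem, ae_iff]
  convert h0 using 2
  ext x
  simp

/-- The Laplace transform of a waiting time. -/
noncomputable def waitTransform (a : ℝ) : ℝ := mgf (M.wait 0) P (-a)

lemma waitTransform_nonneg (a : ℝ) : 0 ≤ M.waitTransform a := mgf_nonneg

lemma integrable_exp_neg_wait [IsProbabilityMeasure P] {a : ℝ} (ha : 0 ≤ a) :
    Integrable (fun ω => Real.exp (-a * M.wait 0 ω)) P := by
  refine Integrable.of_bound (C := 1)
    (((M.measurable_wait 0).const_mul _).exp).aestronglyMeasurable ?_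
  filter_upwards [M.ae_wait_pos 0] with ω hω
  rw [Real.norm_of_nonneg (Real.exp_pos _).le, Real.exp_le_one_iff]
  nlinarith

lemma waitTransform_lt_one [IsProbabilityMeasure P] {a : ℝ} (ha : 0 < a) :
    M.waitTransform a < 1 := by
  have hint := M.integrable_exp_neg_wait ha.le
  have h1 : 0 < ∫ ω, (1 - Real.exp (-a * M.wait 0 ω)) ∂P := by
    rw [integral_pos_iff_support_of_nonneg_ae]
    · rw [pos_iff_ne_zero]
      intro h0
      have hfalse : ∀ᵐ ω ∂P, False := by
        filter_upwards [measure_eq_zero_iff_ae_notMem.1 h0, M.ae_wait_pos 0] with ω h1 h2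
        rw [Function.notMem_support, sub_eq_zero] at h1
        have h3 := (Real.exp_eq_one_iff _).1 h1.symm
        nlinarith
      exact hfalse.exists.choose_spec
    · filter_upwards [M.ae_wait_pos 0] with ω hω
      simp only [Pi.zero_apply, sub_nonneg, Real.exp_le_one_iff]
      nlinarith
    · exact (integrable_const _).sub hint
  rw [integral_sub (integrable_const _) hint] at h1
  simp only [integral_const, probReal_univ, smul_eq_mul, mul_one] at h1
  simpa [waitTransform, mgf] using h1

lemma mgf_wait (n : ℕ) (t : ℝ) : mgf (M.wait n) P t = mgf (M.wait 0) P t := by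
  have h := fun n => (M.hasLaw_wait n).integral_comp (f := fun x : ℝ => Real.exp (t * x))
    (by fun_prop)
  simpa [mgf, Function.comp_def] using (h n).trans (h 0).symm

lemma lintegral_exp_neg_arrival [IsProbabilityMeasure P] {a : ℝ} (ha : 0 ≤ a) (n : ℕ) :
    ∫⁻ ω, ENNReal.ofReal (Real.exp (-a * M.arrival n ω)) ∂P
      = ENNReal.ofReal (M.waitTransform a ^ (n + 1)) := by
  have hm := (M.iIndepFun_wait).mgf_sum (t := -a) M.measurable_wait (Finset.range (n + 1))
  simp only [M.mgf_wait, Finset.prod_const, Finset.card_range] at hm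
  have he : (∑ i ∈ Finset.range (n + 1), M.wait i) = M.arrival n := by
    ext ω
    simp [arrival]
  rw [waitTransform, ← hm, he, mgf, ofReal_integral_eq_lintegral_ofReal]
  · refine Integrable.of_bound (C := 1)
      (((M.measurable_arrival n).const_mul _).exp).aestronglyMeasurable ?_
    filter_upwards [ae_all_iff.2 M.ae_wait_pos] with ω hω
    rw [Real.norm_of_nonneg (Real.exp_pos _).le, Real.exp_le_one_iff]
    have : 0 ≤ M.arrival n ω := Finset.sum_nonneg fun i _ => (hω i).le
    nlinarith
  · exact Eventually.of_forall fun ω => (Real.exp_pos _).le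

/-- The sum `∑ E[e^{-a T_n}]` over the arrival times. -/
noncomputable def arrivalSum (a : ℝ) : ℝ := ∑' n, M.waitTransform a ^ (n + 1)

lemma tsum_lintegral_exp_neg_arrival [IsProbabilityMeasure P] {a : ℝ} (ha : 0 < a) :
    ∑' n, ∫⁻ ω, ENNReal.ofReal (Real.exp (-a * M.arrival n ω)) ∂P
      = ENNReal.ofReal (M.arrivalSum a) := by
  have h0 := M.waitTransform_nonneg a
  simp_rw [M.lintegral_exp_neg_arrival ha.le]
  rw [arrivalSum, ENNReal.ofReal_tsum_of_nonneg (fun n => pow_nonneg h0 _)]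
  exact (summable_nat_add_iff 1).2 (summable_geometric_of_lt_one h0 (M.waitTransform_lt_one ha))

lemma arrivalSum_nonneg (a : ℝ) : 0 ≤ M.arrivalSum a :=
  tsum_nonneg fun _ => pow_nonneg (M.waitTransform_nonneg a) _

/-- The series of `exp (-T_n)` has finite expectation, so almost surely its terms tend to `0`, that
is `T_n → ∞`. -/
lemma ae_regular [IsProbabilityMeasure P] : ∀ᵐ ω ∂P, M.Regular ω := by
  have hmeas : ∀ n, Measurable fun ω => ENNReal.ofReal (Real.exp (-1 * M.arrival n ω)) := fun n =>
    ((M.measurable_arrival n).const_mul _).exp.ennreal_ofReal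
  have hsum := M.tsum_lintegral_exp_neg_arrival one_pos
  rw [← lintegral_tsum fun n => (hmeas n).aemeasurable] at hsum
  have hfin := ae_lt_top (Measurable.tsum hmeas) (hsum ▸ ENNReal.ofReal_ne_top)
  filter_upwards [ae_all_iff.2 M.ae_wait_pos, hfin] with ω h1 h2
  refine ⟨h1, ?_⟩
  have h3 := ENNReal.tendsto_atTop_zero_of_tsum_ne_top h2.ne
  have h4 := (ENNReal.tendsto_toReal ENNReal.zero_ne_top).comp h3
  simp only [Function.comp_def, ENNReal.toReal_ofReal (Real.exp_pos _).le, ENNReal.toReal_zero]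
    at h4
  rw [Real.tendsto_exp_comp_nhds_zero] at h4
  simpa [Function.comp_def] using tendsto_neg_atBot_atTop.comp h4

variable {M}

lemma Regular.strictMono_arrival {ω : Ω} (hω : M.Regular ω) :
    StrictMono fun n => M.arrival n ω :=
  strictMono_nat_of_lt_succ fun n => by
    rw [arrival, arrival, Finset.sum_range_succ _ (n + 1)]
    linarith [hω.1 (n + 1)]

lemma Regular.arrival_pos {ω : Ω} (hω : M.Regular ω) (n : ℕ) : 0 < M.arrival n ω :=
  Finset.sum_pos (fun i _ => hω.1 i) ⟨0, by simp⟩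

/-- Since arrivals increase to infinity, those up to `t` form a finite initial segment. Regularity
also rules out the default value `0` of `ncard` on infinite sets. -/
lemma Regular.arrival_le_iff {ω : Ω} (hω : M.Regular ω) {n : ℕ} {t : ℝ≥0} :
    M.arrival n ω ≤ t ↔ n < M.claimCount t ω := by
  classical
  have hex : ∃ n, (t : ℝ) < M.arrival n ω := (hω.2.eventually_gt_atTop (t : ℝ)).exists
  have hset : {n : ℕ | M.arrival n ω ≤ t} = Iio (Nat.find hex) := by
    ext k
    simp only [mem_ofPred_eq, mem_Iio, Nat.lt_find_iff, not_lt]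
    exact ⟨fun h m hm => (hω.strictMono_arrival.monotone hm).trans h, fun h => h k le_rfl⟩
  have hk : n ∈ {n : ℕ | M.arrival n ω ≤ t} ↔ n < M.claimCount t ω := by
    rw [claimCount, hset, ← Finset.coe_Iio, Set.ncard_coe_finset]
    simp
  exact hk

lemma Regular.lt_arrival_iff {ω : Ω} (hω : M.Regular ω) {n : ℕ} {t : ℝ≥0} :
    t < M.arrival n ω ↔ M.claimCount t ω ≤ n := by
  rw [← not_le, hω.arrival_le_iff, not_lt]

lemma Regular.claimCount_mono {ω : Ω} (hω : M.Regular ω) : Monotone fun t => M.claimCount t ω := by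
  intro s t hst
  by_contra hcon
  have h := hω.arrival_le_iff.2 (not_le.1 hcon)
  exact lt_irrefl _ (hω.arrival_le_iff.1 (h.trans (NNReal.coe_le_coe.2 hst)))

end CramerLundberg

/-! ### Present value of a rate path up to a given time -/

/-- The present value of dividends paid at rate `c` up to time `τ`. -/
noncomputable def presentValue (q : ℝ) (c : ℝ → ℝ) (τ : ℝ≥0∞) : ℝ :=
  ∫ s in {s : ℝ | 0 ≤ s ∧ ENNReal.ofReal s < τ}, Real.exp (-q * s) * c s

lemma measurableSet_ofReal_lt (τ : ℝ≥0∞) :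
    MeasurableSet {s : ℝ | 0 ≤ s ∧ ENNReal.ofReal s < τ} :=
  measurableSet_Ici.inter (measurableSet_lt ENNReal.measurable_ofReal measurable_const)

section PresentValue

variable {q b : ℝ} {c : ℝ → ℝ}

lemma integrableOn_exp_mul (hq : 0 < q) (hc : Monotone c) (h0 : ∀ s, 0 ≤ c s) (hb : ∀ s, c s ≤ b) :
    IntegrableOn (fun s => Real.exp (-q * s) * c s) (Ici 0) := by
  refine Integrable.mul_bdd (c := b) ?_ hc.measurable.aestronglyMeasurable
    (Eventually.of_forall fun s => by rw [Real.norm_of_nonneg (h0 s)]; exact hb s)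
  rw [← IntegrableOn, integrableOn_Ici_iff_integrableOn_Ioi]
  exact integrableOn_exp_mul_Ioi (by linarith) 0

lemma setIntegral_exp_mul_le (hq : 0 < q) (hc : Monotone c) (h0 : ∀ s, 0 ≤ c s)
    (hb : ∀ s, c s ≤ b) {a : ℝ} (ha : 0 ≤ a) {S : Set ℝ} (hSa : S ⊆ Ici a) :
    ∫ s in S, Real.exp (-q * s) * c s ≤ b / q * Real.exp (-q * a) := by
  have hb0 := (h0 0).trans (hb 0)
  have hint : IntegrableOn (fun s : ℝ => Real.exp (-q * s) * b) (Ici a) := by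
    rw [integrableOn_Ici_iff_integrableOn_Ioi]
    exact (integrableOn_exp_mul_Ioi (by linarith) a).mul_const _
  have h1 := (integrableOn_exp_mul hq hc h0 hb).mono_set (hSa.trans (Ici_subset_Ici.2 ha))
  calc ∫ s in S, Real.exp (-q * s) * c s
      ≤ ∫ s in S, Real.exp (-q * s) * b := setIntegral_mono h1 (hint.mono_set hSa) fun s =>
        mul_le_mul_of_nonneg_left (hb s) (Real.exp_pos _).le
    _ ≤ ∫ s in Ici a, Real.exp (-q * s) * b :=
        setIntegral_mono_set hint (Eventually.of_forall fun s =>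
          mul_nonneg (Real.exp_pos _).le hb0) (Eventually.of_forall hSa)
    _ = b / q * Real.exp (-q * a) := by
        rw [integral_Ici_eq_integral_Ioi, integral_mul_const,
          integral_exp_mul_Ioi (by linarith) a]
        field_simp

lemma presentValue_nonneg (h0 : ∀ s, 0 ≤ c s) (τ : ℝ≥0∞) : 0 ≤ presentValue q c τ :=
  integral_nonneg fun s => mul_nonneg (Real.exp_pos _).le (h0 s)

lemma presentValue_le (hq : 0 < q) (hc : Monotone c) (h0 : ∀ s, 0 ≤ c s) (hb : ∀ s, c s ≤ b)
    (τ : ℝ≥0∞) : presentValue q c τ ≤ b / q := by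
  have h := setIntegral_exp_mul_le (S := {s : ℝ | 0 ≤ s ∧ ENNReal.ofReal s < τ}) hq hc h0 hb le_rfl
    fun _ hs => hs.1
  rwa [mul_zero, Real.exp_zero, mul_one] at h

lemma presentValue_mono (hq : 0 < q) (hc : Monotone c) (h0 : ∀ s, 0 ≤ c s) (hb : ∀ s, c s ≤ b)
    {τ τ' : ℝ≥0∞} (h : τ' ≤ τ) : presentValue q c τ' ≤ presentValue q c τ :=
  setIntegral_mono_set ((integrableOn_exp_mul hq hc h0 hb).mono_set fun _ hs => hs.1)
    (Eventually.of_forall fun s => mul_nonneg (Real.exp_pos _).le (h0 s))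
    (Eventually.of_forall fun _ hs => ⟨hs.1, hs.2.trans_le h⟩)

lemma setIntegral_ofReal_lt_le {f : ℝ → ℝ} (hf : IntegrableOn f (Ici 0)) {h : ℝ}
    (hle : ∀ θ, 0 ≤ θ → ∫ s in 0..θ, f s ≤ h) (τ : ℝ≥0∞) :
    ∫ s in {s : ℝ | 0 ≤ s ∧ ENNReal.ofReal s < τ}, f s ≤ h := by
  rcases eq_or_ne τ ∞ with rfl | hτ
  · have hset : {s : ℝ | 0 ≤ s ∧ ENNReal.ofReal s < ∞} = Ici 0 := by
      ext s
      simp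
    rw [hset, integral_Ici_eq_integral_Ioi]
    exact le_of_tendsto (intervalIntegral_tendsto_integral_Ioi 0
      (hf.mono_set Ioi_subset_Ici_self) tendsto_id)
      ((eventually_ge_atTop 0).mono fun θ hθ => hle θ hθ)
  · have hset : {s : ℝ | 0 ≤ s ∧ ENNReal.ofReal s < τ} = Ico 0 τ.toReal := by
      ext s
      simp only [mem_ofPred_eq, mem_Ico]
      refine and_congr_right fun hs => ?_
      rw [ENNReal.ofReal_lt_iff_lt_toReal hs hτ]
    have := hle τ.toReal ENNReal.toReal_nonneg
    rwa [intervalIntegral.integral_of_le ENNReal.toReal_nonneg, integral_Ioc_eq_integral_Ioo,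
      ← integral_Ico_eq_integral_Ioo, ← hset] at this

lemma presentValue_le_add {d : ℝ → ℝ} (hq : 0 < q) (hc : Monotone c) (h0 : ∀ s, 0 ≤ c s)
    (hb : ∀ s, c s ≤ b) (hd : Monotone d) (hd0 : ∀ s, 0 ≤ d s) (hdb : ∀ s, d s ≤ b) {h : ℝ}
    (hle : ∀ θ, 0 ≤ θ → ∫ s in 0..θ, Real.exp (-q * s) * (c s - d s) ≤ h) (τ : ℝ≥0∞) :
    presentValue q c τ ≤ presentValue q d τ + h := by
  have hci := integrableOn_exp_mul hq hc h0 hb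
  have hdi := integrableOn_exp_mul hq hd hd0 hdb
  have h1 : ∫ s in {s : ℝ | 0 ≤ s ∧ ENNReal.ofReal s < τ}, Real.exp (-q * s) * (c s - d s) ≤ h :=
    setIntegral_ofReal_lt_le ((hci.sub hdi).congr (by simp [mul_sub, Pi.sub_def])) hle τ
  simp only [mul_sub] at h1
  rw [integral_sub (hci.mono_set fun _ hs => hs.1) (hdi.mono_set fun _ hs => hs.1)] at h1
  unfold presentValue
  linarith

/-- The two integrals differ only on times after `τ' ≥ a`, where paying at most `b` forever is worth
`(b / q) exp (-q a)`. -/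
lemma presentValue_le_add_exp (hq : 0 < q) (hc : Monotone c) (h0 : ∀ s, 0 ≤ c s)
    (hb : ∀ s, c s ≤ b) {a : ℝ} {τ τ' : ℝ≥0∞} (ha : 0 ≤ a) (haτ : ENNReal.ofReal a ≤ τ')
    (hτ : τ' ≤ τ) : presentValue q c τ ≤ presentValue q c τ' + b / q * Real.exp (-q * a) := by
  have hci := integrableOn_exp_mul hq hc h0 hb
  have hsub : {s : ℝ | 0 ≤ s ∧ ENNReal.ofReal s < τ'} ⊆ {s : ℝ | 0 ≤ s ∧ ENNReal.ofReal s < τ} :=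
    fun s hs => ⟨hs.1, hs.2.trans_le hτ⟩
  have h3 := setIntegral_sdiff (measurableSet_ofReal_lt τ')
    (hci.mono_set fun s (hs : s ∈ {s : ℝ | 0 ≤ s ∧ ENNReal.ofReal s < τ}) => hs.1) hsub
  have h4 := setIntegral_exp_mul_le hq hc h0 hb ha
    (S := {s : ℝ | 0 ≤ s ∧ ENNReal.ofReal s < τ} \ {s : ℝ | 0 ≤ s ∧ ENNReal.ofReal s < τ'})
    (fun s hs => by
      by_contra hcon
      exact hs.2 ⟨hs.1.1, ((ENNReal.ofReal_lt_ofReal_iff_of_nonneg hs.1.1).2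
        (not_le.1 hcon)).trans_le haτ⟩)
  unfold presentValue
  linarith

end PresentValue

/-! ### Measurability of the ruin time and of the payoff -/

lemma measurable_setIntegral_of_continuousWithinAt_Ici {Ω : Type*} {m : MeasurableSpace Ω}
    {f : ℝ → Ω → ℝ} (hf : ∀ s, Measurable (f s))
    (hc : ∀ ω s, ContinuousWithinAt (fun s => f s ω) (Ici s) s) (S : Set ℝ) :
    Measurable fun ω => ∫ s in S, f s ω :=
  (((measurable_uncurry_of_continuousWithinAt_Ici hf hc).comp
    measurable_swap).stronglyMeasurable.integral_prod_right' (ν := volume.restrict S)).measurable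

namespace CramerLundberg

variable {Ω : Type*} [MeasurableSpace Ω] {P : Measure Ω} {M : CramerLundberg P}

lemma Regular.claimCount_eq {ω : Ω} (hω : M.Regular ω) {s t : ℝ≥0} (hts : t ≤ s)
    (hs : s < M.arrival (M.claimCount t ω) ω) : M.claimCount s ω = M.claimCount t ω :=
  le_antisymm (hω.lt_arrival_iff.1 hs) (hω.claimCount_mono hts)

lemma strategyValue_eq (M : CramerLundberg P) (q x : ℝ) (C : ℝ≥0 → Ω → ℝ) :
    M.strategyValue q x C
      = ∫ ω, presentValue q (fun s => C s.toNNReal ω) (M.ruinTime x C ω) ∂P := rfl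

lemma continuousWithinAt_comp_toNNReal {f : ℝ≥0 → ℝ}
    (hf : ∀ t, ContinuousWithinAt f (Ici t) t) (s : ℝ) :
    ContinuousWithinAt (fun s : ℝ => f s.toNNReal) (Ici s) s :=
  (hf s.toNNReal).comp continuous_real_toNNReal.continuousWithinAt
    fun _ hu => Real.toNNReal_le_toNNReal hu

section Admissible

variable [P.IsComplete] {cbar c : ℝ} {C : ℝ≥0 → Ω → ℝ}

lemma IsAdmissible.monotone_toNNReal (hC : M.IsAdmissible cbar c C) (ω : Ω) :
    Monotone fun s : ℝ => C s.toNNReal ω :=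
  fun _ _ h => hC.monotone ω (Real.toNNReal_mono h)

lemma IsAdmissible.measurable (hC : M.IsAdmissible cbar c C) (t : ℝ≥0) : Measurable (C t) :=
  (hC.adapted t).mono (M.filtration.le t) le_rfl

lemma IsAdmissible.measurable_controlledSurplus (hC : M.IsAdmissible cbar c C) (x : ℝ) (t : ℝ≥0) :
    Measurable (M.controlledSurplus x C t) :=
  (M.measurable_freeSurplus x t).sub (by
    simp only [intervalIntegral.integral_of_le (NNReal.coe_nonneg t)]
    exact measurable_setIntegral_of_continuousWithinAt_Ici (f := fun s ω => C s.toNNReal ω)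
      (fun s => hC.measurable _)
      (fun ω s => continuousWithinAt_comp_toNNReal (hC.right_continuous ω) s) _)

/-- No claim arrives immediately after `t`, so the surplus is right-continuous there. Hence
negativity is also seen at rational times, and the ruin time becomes a countable infimum. -/
lemma IsAdmissible.eventually_controlledSurplus_neg (hC : M.IsAdmissible cbar c C) {x : ℝ} {ω : Ω}
    (hω : M.Regular ω) {t : ℝ≥0} (ht : M.controlledSurplus x C t ω < 0) :
    ∀ᶠ s in 𝓝[≥] t, M.controlledSurplus x C s ω < 0 := by
  set n := M.claimCount t ω
  have hcont : Continuous fun s : ℝ≥0 => x + M.premium * s - ∑ i ∈ Finset.range n, M.claim i ω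
      - ∫ u in (0 : ℝ)..s, C u.toNNReal ω := by
    have h1 : Continuous fun s : ℝ => ∫ u in (0 : ℝ)..s, C u.toNNReal ω :=
      intervalIntegral.continuous_primitive
        (fun _ _ => (hC.monotone_toNNReal ω).intervalIntegrable) 0
    have h2 : Continuous fun s : ℝ≥0 => ∫ u in (0 : ℝ)..s, C u.toNNReal ω :=
      h1.comp NNReal.continuous_coe
    fun_prop
  have h1 := (hcont.tendsto t).eventually (gt_mem_nhds ht)
  have h2 : ∀ᶠ s : ℝ≥0 in 𝓝 t, (s : ℝ) < M.arrival n ω :=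
    (NNReal.continuous_coe.tendsto t).eventually (gt_mem_nhds (hω.lt_arrival_iff.2 le_rfl))
  filter_upwards [nhdsWithin_le_nhds h1, nhdsWithin_le_nhds h2, self_mem_nhdsWithin] with s h1 h2 h3
  rw [controlledSurplus, freeSurplus, hω.claimCount_eq h3 h2]
  exact h1

lemma IsAdmissible.ruinTime_eq (hC : M.IsAdmissible cbar c C) (x : ℝ) {ω : Ω}
    (hω : M.Regular ω) :
    M.ruinTime x C ω = ⨅ r : ℚ, {ω | M.controlledSurplus x C (r : ℝ).toNNReal ω < 0}.piecewise
      (fun _ => ENNReal.ofReal r) (fun _ => ∞) ω := by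
  set I := ⨅ r : ℚ, {ω | M.controlledSurplus x C (r : ℝ).toNNReal ω < 0}.piecewise
      (fun _ => ENNReal.ofReal r) (fun _ => ∞) ω with hI
  refine le_antisymm (le_iInf fun r => ?_) (le_sInf ?_)
  · by_cases h : ω ∈ {ω | M.controlledSurplus x C (r : ℝ).toNNReal ω < 0}
    · rw [piecewise_eq_of_mem _ _ _ h]
      exact sInf_le ⟨_, h, rfl⟩
    · rw [piecewise_eq_of_notMem _ _ _ h]
      exact le_top
  · rintro _ ⟨t, ht, rfl⟩
    by_contra hcon
    have h1 : ∀ᶠ s : ℝ≥0 in 𝓝 t, (s : ℝ≥0∞) < I :=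
      (ENNReal.continuous_coe.tendsto t).eventually (gt_mem_nhds (not_le.1 hcon))
    have h2 := (h1.filter_mono nhdsWithin_le_nhds).and (f := 𝓝[≥] t)
      (hC.eventually_controlledSurplus_neg hω ht)
    obtain ⟨u, hu, hsub⟩ := (mem_nhdsGE_iff_exists_Ico_subset).1 h2
    obtain ⟨r, -, hr1, hr2⟩ := (NNReal.lt_iff_exists_rat_btwn t u).1 hu
    have h3 := hsub ⟨hr1.le, hr2⟩
    refine absurd (iInf_le _ r : I ≤ _) (not_le.2 ?_)
    rw [piecewise_eq_of_mem _ _ _ (by exact h3.2)]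
    exact h3.1

lemma IsAdmissible.aemeasurable_ruinTime [IsProbabilityMeasure P] (hC : M.IsAdmissible cbar c C)
    (x : ℝ) : AEMeasurable (M.ruinTime x C) P := by
  refine ⟨fun ω => ⨅ r : ℚ, {ω | M.controlledSurplus x C (r : ℝ).toNNReal ω < 0}.piecewise
      (fun _ => ENNReal.ofReal r) (fun _ => ∞) ω, ?_, ?_⟩
  · exact Measurable.iInf fun r => Measurable.piecewise
      (measurableSet_lt (hC.measurable_controlledSurplus x _) measurable_const)
      measurable_const measurable_const
  · filter_upwards [M.ae_regular] with ω hω using hC.ruinTime_eq x hω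

lemma IsAdmissible.integrable_presentValue [IsProbabilityMeasure P] {q : ℝ} (hq : 0 < q)
    (hc : 0 ≤ c) (hC : M.IsAdmissible cbar c C) (x : ℝ) :
    Integrable (fun ω => presentValue q (fun s => C s.toNNReal ω) (M.ruinTime x C ω)) P := by
  have h0 : ∀ s ω, 0 ≤ C s ω := fun s ω => hc.trans (hC.lower s ω)
  refine Integrable.of_bound (C := cbar / q) ?_ (Eventually.of_forall fun ω => ?_)
  · obtain ⟨τ, hτ, hτ'⟩ := hC.aemeasurable_ruinTime x
    have hmeas : Measurable fun z : ℝ × Ω => C z.1.toNNReal z.2 :=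
      measurable_uncurry_of_continuousWithinAt_Ici (fun s => hC.measurable _)
        fun ω s => continuousWithinAt_comp_toNNReal (hC.right_continuous ω) s
    have hset : MeasurableSet {z : ℝ × Ω | 0 ≤ z.1 ∧ ENNReal.ofReal z.1 < τ z.2} :=
      (measurableSet_le measurable_const measurable_fst).inter
        (measurableSet_lt (ENNReal.measurable_ofReal.comp measurable_fst)
          (hτ.comp measurable_snd))
    have h1 : Measurable fun z : ℝ × Ω => Real.exp (-q * z.1) * C z.1.toNNReal z.2 :=
      (measurable_fst.const_mul _).exp.mul hmeas
    have h2 := ((h1.indicator hset).comp measurable_swap).stronglyMeasurable.integral_prod_right'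
      (ν := volume)
    refine ⟨_, h2, ?_⟩
    filter_upwards [hτ'] with ω hω
    rw [presentValue, hω, ← integral_indicator (measurableSet_ofReal_lt _)]
    rfl
  · rw [Real.norm_of_nonneg (presentValue_nonneg (fun s => h0 _ ω) _)]
    exact presentValue_le hq (hC.monotone_toNNReal ω) (fun s => h0 _ ω) (fun s => hC.upper _ ω) _

end Admissible

end CramerLundberg

/-! ### Admissibility of the capped strategy -/

namespace CramerLundberg

variable {Ω : Type*} [MeasurableSpace Ω] {P : Measure Ω} (M : CramerLundberg P)

/-- The strategy `C` raised to the rate `b` and capped at the premium rate until the advantage `h`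
in surplus is used up. -/
noncomputable def cappedStrategy (h b : ℝ) (C : ℝ≥0 → Ω → ℝ) (t : ℝ≥0) (ω : Ω) : ℝ :=
  cappedRate h b M.premium (fun s => C s.toNNReal ω) t

variable {M}

lemma IsAdmissible.cappedStrategy [P.IsComplete] {cbar c h b : ℝ} {C : ℝ≥0 → Ω → ℝ}
    (hC : M.IsAdmissible cbar c C) (hh : 0 < h) (hb : b ≤ cbar) (hbp : b ≤ M.premium) :
    M.IsAdmissible cbar b (M.cappedStrategy h b C) := by
  have hmono : ∀ ω, Monotone fun t => M.cappedStrategy h b C t ω := fun ω s t hst =>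
    cappedRate_monotoneOn hbp (hC.monotone_toNNReal ω) hh (NNReal.coe_nonneg s)
      (NNReal.coe_nonneg t) (NNReal.coe_le_coe.2 hst)
  refine ⟨fun t => ?_, fun ω t => ?_, fun ω t => ⟨_, (hmono ω).tendsto_nhdsLT t⟩, hmono,
    fun t ω => le_cappedRate hbp (hC.monotone_toNNReal ω) hh t.2,
    fun t ω => cappedRate_le hb (fun s => hC.upper _ ω) _⟩
  · have hgap : Measurable[M.filtration t]
        fun ω => rateGap h b M.premium (fun s => C s.toNNReal ω) t := by
      -- Stopping the time argument of `C` at `t` changes nothing on `[0, t]` and makes every value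
      -- of the integrand measurable at time `t`.
      have h1 : Measurable[M.filtration t] fun ω => ∫ s in (0 : ℝ)..t,
          (max b (min (C (min s.toNNReal t) ω) M.premium) - C (min s.toNNReal t) ω) := by
        simp only [intervalIntegral.integral_of_le (NNReal.coe_nonneg t)]
        refine measurable_setIntegral_of_continuousWithinAt_Ici (m := M.filtration t)
          (fun s => ?_) (fun ω s => ?_) _
        · have hs : Measurable[M.filtration t] (C (min s.toNNReal t)) :=
            (hC.adapted _).mono (M.filtration.mono (min_le_right _ _)) le_rfl
          exact (measurable_const.max (hs.min measurable_const)).sub hs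
        · have h2 : ContinuousWithinAt (fun s : ℝ => C (min s.toNNReal t) ω) (Ici s) s :=
            (hC.right_continuous ω (min s.toNNReal t)).comp (g := fun u => C u ω)
              (f := fun s : ℝ => min s.toNNReal t)
              (continuous_real_toNNReal.min continuous_const).continuousWithinAt
              fun u hu => min_le_min (Real.toNNReal_le_toNNReal hu) le_rfl
          exact (continuousWithinAt_const.max (h2.min continuousWithinAt_const)).sub h2
      convert measurable_const.add h1 using 2 with ω
      rw [rateGap]
      congr 1
      refine intervalIntegral.integral_congr fun s hs => ?_
      rw [uIcc_of_le (NNReal.coe_nonneg t)] at hs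
      simp only [min_eq_left (Real.toNNReal_le_iff_le_coe.2 hs.2)]
    have hCt := hC.adapted t
    have : M.cappedStrategy h b C t = {ω | rateGap h b M.premium (fun s => C s.toNNReal ω) t
        ≤ 0}.piecewise (C t) (fun ω => max b (min (C t ω) M.premium)) := by
      ext ω
      by_cases hg : rateGap h b M.premium (fun s => C s.toNNReal ω) t ≤ 0
      · rw [piecewise_eq_of_mem _ _ _ (by exact hg), CramerLundberg.cappedStrategy,
          cappedRate_of_nonpos hg, Real.toNNReal_coe]
      · rw [piecewise_eq_of_notMem _ _ _ (by exact hg), CramerLundberg.cappedStrategy,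
          cappedRate_of_pos (not_le.1 hg), Real.toNNReal_coe]
    rw [this]
    exact Measurable.piecewise (hgap measurableSet_Iic) hCt
      (measurable_const.max (hCt.min measurable_const))
  · exact (continuousWithinAt_cappedRate hbp (hC.monotone_toNNReal ω) hh t.2
      (continuousWithinAt_comp_toNNReal (hC.right_continuous ω) _)).comp
      NNReal.continuous_coe.continuousWithinAt fun u hu => NNReal.coe_le_coe.2 hu

/-! ### Independence of a claim from everything before it -/

variable (M)

/-- The waiting times and the sizes of the claims before claim `n`. -/
def priorData (n : ℕ) (ω : Ω) : (Finset.range n → ℝ) × (ℕ → ℝ) :=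
  (fun i => M.claim i ω, fun k => M.wait k ω)

/-- Claim `n` is independent of the earlier claims, and all of these are independent of the waiting
times. The joint law is thus a triple product, which only has to be reassociated. -/
lemma indepFun_claim_priorData [IsProbabilityMeasure P] (n : ℕ) :
    IndepFun (M.priorData n) (M.claim n) P := by
  have hB : Measurable fun ω => fun i : Finset.range n => M.claim i ω :=
    measurable_pi_lambda _ fun i => M.measurable_claim i
  have hW : Measurable fun ω => fun k => M.wait k ω := measurable_pi_lambda _ M.measurable_wait
  have hU := M.measurable_claim n
  have h1 : IndepFun (M.claim n) (fun ω => fun i : Finset.range n => M.claim i ω) P := by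
    have := (M.iIndepFun_claim).indepFun_finset {n} (Finset.range n) (by simp) M.measurable_claim
    exact this.comp (φ := fun f : ({n} : Finset ℕ) → ℝ => f ⟨n, by simp⟩) (ψ := fun g => g)
      (measurable_pi_apply (⟨n, by simp⟩ : ({n} : Finset ℕ))) measurable_id
  have h2 : IndepFun (fun ω => (M.claim n ω, fun i : Finset.range n => M.claim i ω))
      (fun ω => fun k => M.wait k ω) P := by
    have := M.indepFun_wait_claim.symm
    exact this.comp (φ := fun f => (f n, fun i : Finset.range n => f i)) (ψ := id)
      (by fun_prop) measurable_id
  refine IndepFun.symm ?_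
  have h3 := h2.comp measurable_snd measurable_id
  have e1 := (indepFun_iff_map_prod_eq_prod_map_map hU.aemeasurable hB.aemeasurable).1 h1
  have e2 := (indepFun_iff_map_prod_eq_prod_map_map (hU.prodMk hB).aemeasurable
    hW.aemeasurable).1 h2
  have e3 := (indepFun_iff_map_prod_eq_prod_map_map hB.aemeasurable hW.aemeasurable).1 h3
  refine (indepFun_iff_map_prod_eq_prod_map_map hU.aemeasurable
    (hB.prodMk hW).aemeasurable).2 ?_
  have := Measure.isProbabilityMeasure_map (μ := P) hU.aemeasurable
  have := Measure.isProbabilityMeasure_map (μ := P) hB.aemeasurable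
  have := Measure.isProbabilityMeasure_map (μ := P) hW.aemeasurable
  rw [e3, ← Measure.prodAssoc_prod, ← e1, ← e2, Measure.map_map (by fun_prop)
    ((hU.prodMk hB).prodMk hW)]
  rfl

/-- The events that depend, up to null sets, on the data prior to claim `n` only. -/
noncomputable abbrev priorEvents (n : ℕ) : MeasurableSpace Ω :=
  eventuallyMeasurableSpace (MeasurableSpace.comap (M.priorData n) inferInstance) (ae P)

lemma measurable_wait_priorEvents (n k : ℕ) : Measurable[M.priorEvents n] (M.wait k) :=
  Measurable.eventuallyMeasurable ((measurable_pi_apply k).comp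
    (measurable_snd.comp (comap_measurable (M.priorData n))))

lemma measurable_claim_priorEvents {n i : ℕ} (hi : i < n) :
    Measurable[M.priorEvents n] (M.claim i) :=
  Measurable.eventuallyMeasurable ((measurable_pi_apply (⟨i, by simpa⟩ : Finset.range n)).comp
    (measurable_fst.comp (comap_measurable (M.priorData n))))

lemma measurable_arrival_priorEvents (n k : ℕ) : Measurable[M.priorEvents n] (M.arrival k) :=
  Finset.measurable_fun_sum _ fun i _ => M.measurable_wait_priorEvents n i

lemma indepFun_claim_of_priorEvents [IsProbabilityMeasure P] {β : Type*} [MeasurableSpace β]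
    {n : ℕ} {f : Ω → β} (hf : Measurable[M.priorEvents n] f) : IndepFun f (M.claim n) P := by
  rw [indepFun_iff_measure_inter_preimage_eq_mul]
  intro s t hs ht
  obtain ⟨A, ⟨B, hB, rfl⟩, hA⟩ := hf hs
  have h1 : P (f ⁻¹' s ∩ M.claim n ⁻¹' t) = P (M.priorData n ⁻¹' B ∩ M.claim n ⁻¹' t) :=
    measure_congr (hA.inter (EventuallyEq.refl _ _))
  rw [h1, measure_congr hA]
  exact (M.indepFun_claim_priorData n).measure_inter_preimage_eq_mul _ _ hB ht

/-- Before `T_n` at most `n` claims have occurred. Replacing the random number of terms by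
indicators expresses the surplus through prior data. -/
lemma freeSurplus_eq_of_lt_arrival {ω : Ω} (hω : M.Regular ω) {n : ℕ} {t : ℝ≥0} (x : ℝ)
    (ht : t < M.arrival n ω) : M.freeSurplus x t ω = x + M.premium * t
      - ∑ i ∈ Finset.range n, {ω | M.arrival i ω ≤ t}.indicator (M.claim i) ω := by
  rw [freeSurplus]
  congr 1
  rw [← Finset.sum_subset (Finset.range_mono (hω.lt_arrival_iff.1 ht))]
  · refine Finset.sum_congr rfl fun i hi => (indicator_of_mem ?_ _).symm
    exact hω.arrival_le_iff.2 (Finset.mem_range.1 hi)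
  · intro i _ hi
    refine indicator_of_notMem (fun h => hi (Finset.mem_range.2 ?_)) _
    exact hω.arrival_le_iff.1 h

/-- The sets whose trace on `E` is measurable. -/
@[reducible]
def tracePreimage {α : Type*} {m : MeasurableSpace α} {E : Set α} (hE : MeasurableSet E) :
    MeasurableSpace α where
  MeasurableSet' A := MeasurableSet (A ∩ E)
  measurableSet_empty := by simp
  measurableSet_compl A hA := by
    have : Aᶜ ∩ E = E \ (A ∩ E) := by
      ext ω
      simp
      tauto
    rw [this]
    exact hE.diff hA
  measurableSet_iUnion f hf := by
    rw [iUnion_inter]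
    exact MeasurableSet.iUnion hf

/-- Before the arrival of claim `n`, the filtration contains only events that depend on the data
prior to claim `n`. -/
lemma measurableSet_inter_lt_arrival [P.IsComplete] [IsProbabilityMeasure P] {n : ℕ} {t : ℝ≥0}
    {A : Set Ω} (hA : MeasurableSet[M.filtration t] A) :
    MeasurableSet[M.priorEvents n] (A ∩ {ω | t < M.arrival n ω}) := by
  have hE : MeasurableSet[M.priorEvents n] {ω | (t : ℝ) < M.arrival n ω} :=
    M.measurable_arrival_priorEvents n n measurableSet_Ioi
  -- The events whose trace on `{t < T_n}` is prior form a σ-algebra, so only the generators need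
  -- checking: earlier surpluses and null sets.
  have hle : (M.filtration t : MeasurableSpace Ω) ≤ tracePreimage hE := by
    refine sup_le (iSup₂_le fun u hu => ?_) (MeasurableSpace.generateFrom_le fun B hB => ?_)
    · rintro _ ⟨B, hB, rfl⟩
      have hZ : Measurable[M.priorEvents n] fun ω => 0 + M.premium * u
          - ∑ i ∈ Finset.range n, {ω | M.arrival i ω ≤ u}.indicator (M.claim i) ω :=
        measurable_const.sub (Finset.measurable_fun_sum _ fun i hi =>
          (M.measurable_claim_priorEvents (Finset.mem_range.1 hi)).indicator
            (M.measurable_arrival_priorEvents n i measurableSet_Iic))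
      refine EventuallyMeasurableSet.congr (MeasurableSet.inter (hZ hB) hE) ?_
      filter_upwards [M.ae_regular] with ω hω
      refine propext (and_congr_left fun hlt => ?_)
      have := M.freeSurplus_eq_of_lt_arrival hω 0 ((NNReal.coe_le_coe.2 hu).trans_lt hlt)
      change M.freeSurplus 0 u ω ∈ B ↔ _ ∈ B
      rw [this]
    · have h0 : MeasurableSet[M.priorEvents n] B :=
        ⟨∅, @MeasurableSet.empty _ (MeasurableSpace.comap (M.priorData n) inferInstance),
          ae_eq_empty.2 hB⟩
      exact MeasurableSet.inter h0 hE
  exact hle A hA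

/-- The surplus controlled by `C` just before it pays claim `n`. -/
noncomputable def surplusBefore (x : ℝ) (C : ℝ≥0 → Ω → ℝ) (n : ℕ) (ω : Ω) : ℝ :=
  x + M.premium * M.arrival n ω - ∑ i ∈ Finset.range n, M.claim i ω
    - ∫ s in Ioi (0 : ℝ), {ω | s.toNNReal < M.arrival n ω}.indicator (C s.toNNReal) ω

variable {M}

/-- Only the values of `C` at times `s < T_n` enter, and on that event an adapted process sees prior
data alone. Cutting `C` off at `T_n` preserves right-continuity, so the time integral is measurable
as well. -/
lemma IsAdmissible.measurable_surplusBefore [P.IsComplete] [IsProbabilityMeasure P] {cbar c : ℝ}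
    {C : ℝ≥0 → Ω → ℝ} (hC : M.IsAdmissible cbar c C) (x : ℝ) (n : ℕ) :
    Measurable[M.priorEvents n] (M.surplusBefore x C n) := by
  have h1 : ∀ t : ℝ≥0, Measurable[M.priorEvents n]
      ({ω | t < M.arrival n ω}.indicator (C t)) := by
    intro t B hB
    have hE : MeasurableSet[M.priorEvents n] {ω | t < M.arrival n ω} :=
      M.measurable_arrival_priorEvents n n measurableSet_Ioi
    rw [indicator_preimage, Set.ite]
    exact MeasurableSet.union (M.measurableSet_inter_lt_arrival (hC.adapted t hB))
      (MeasurableSet.diff (measurable_const hB) hE)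
  have h2 : ∀ ω t, ContinuousWithinAt
      (fun t : ℝ≥0 => {ω | t < M.arrival n ω}.indicator (C t) ω) (Ici t) t := by
    intro ω t
    rcases lt_or_ge (t : ℝ) (M.arrival n ω) with hs | hs
    · refine (hC.right_continuous ω t).congr_of_eventuallyEq ?_ (indicator_of_mem (by exact hs) _)
      filter_upwards [nhdsWithin_le_nhds
        ((NNReal.continuous_coe.tendsto t).eventually (gt_mem_nhds hs))] with u hu
        using indicator_of_mem (by exact hu) _
    · exact (continuousWithinAt_const (b := (0 : ℝ))).congr
        (fun u hu => indicator_of_notMem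
          (by exact not_lt.2 (hs.trans (NNReal.coe_le_coe.2 hu))) _)
        (indicator_of_notMem (by exact not_lt.2 hs) _)
  have h3 := measurable_setIntegral_of_continuousWithinAt_Ici (m := M.priorEvents n)
    (f := fun s ω => {ω | s.toNNReal < M.arrival n ω}.indicator (C s.toNNReal) ω)
    (fun s => h1 s.toNNReal) (fun ω s => continuousWithinAt_comp_toNNReal (h2 ω) s) (Ioi 0)
  exact ((measurable_const.add ((M.measurable_arrival_priorEvents n n).const_mul _)).sub
    (Finset.measurable_fun_sum _ fun i hi =>
      M.measurable_claim_priorEvents (Finset.mem_range.1 hi))).sub h3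

end CramerLundberg

/-! ### The discounted probability of a separating claim -/

/-- One factor `exp (-q t / 2)` absorbs the linear growth, through `(q / 2) t ≤ exp (q t / 2)`; the
other survives to make the sum over claims converge. -/
lemma mul_exp_neg_le {q h δ t : ℝ} (hq : 0 < q) (hh : 0 ≤ h) (hδ : 0 ≤ δ) (ht : 0 ≤ t) :
    Real.exp (-q * t) * (h + δ * t) ≤ (h + 2 / q * δ) * Real.exp (-(q / 2) * t) := by
  have h1 : Real.exp (-q * t) = Real.exp (-(q / 2) * t) * Real.exp (-(q / 2) * t) := by
    rw [← Real.exp_add]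
    ring_nf
  have h2 : Real.exp (-(q / 2) * t) ≤ 1 := Real.exp_le_one_iff.2 (by nlinarith)
  have h3 : Real.exp (-(q / 2) * t) * t ≤ 2 / q := by
    have h4 : q / 2 * t ≤ Real.exp (q / 2 * t) := by linarith [Real.add_one_le_exp (q / 2 * t)]
    have h5 : t ≤ 2 / q * Real.exp (q / 2 * t) := by
      calc t = 2 / q * (q / 2 * t) := by field_simp
        _ ≤ _ := mul_le_mul_of_nonneg_left h4 (by positivity)
    calc Real.exp (-(q / 2) * t) * t
        ≤ Real.exp (-(q / 2) * t) * (2 / q * Real.exp (q / 2 * t)) :=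
          mul_le_mul_of_nonneg_left h5 (Real.exp_pos _).le
      _ = 2 / q * (Real.exp (-(q / 2) * t) * Real.exp (q / 2 * t)) := by ring
      _ = 2 / q := by rw [← Real.exp_add]; simp
  have h6 := (Real.exp_pos (-(q / 2) * t)).le
  calc Real.exp (-q * t) * (h + δ * t)
      = Real.exp (-(q / 2) * t)
        * (Real.exp (-(q / 2) * t) * h + δ * (Real.exp (-(q / 2) * t) * t)) := by rw [h1]; ring
    _ ≤ Real.exp (-(q / 2) * t) * (1 * h + δ * (2 / q)) := by gcongr
    _ = _ := by ring

namespace CramerLundberg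

variable {Ω : Type*} [MeasurableSpace Ω] {P : Measure Ω} (M : CramerLundberg P)

lemma claimLaw_Ioc_le {K : ℝ} (hK : ∀ x y : ℝ, x < y →
    cdf M.claimLaw y - cdf M.claimLaw x ≤ K * (y - x)) (y z : ℝ) :
    M.claimLaw (Ioc y (y + z)) ≤ ENNReal.ofReal (K * z) := by
  have := M.claimLaw_isProbability
  rcases le_or_gt z 0 with hz | hz
  · rw [Ioc_eq_empty (by linarith)]
    simp
  · nth_rw 1 [← measure_cdf M.claimLaw]
    rw [StieltjesFunction.measure_Ioc]
    refine ENNReal.ofReal_le_ofReal ((hK y (y + z) (by linarith)).trans_eq ?_)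
    ring

lemma priorEvents_le [P.IsComplete] (n : ℕ) : M.priorEvents n ≤ ‹MeasurableSpace Ω› := by
  rintro A ⟨B, hB, hAB⟩
  have hB' : MeasurableSet B := by
    have hm : Measurable (M.priorData n) :=
      (measurable_pi_lambda _ fun i : Finset.range n => M.measurable_claim i).prodMk
        (measurable_pi_lambda _ M.measurable_wait)
    exact hm.comap_le B hB
  exact (NullMeasurableSet.congr hB'.nullMeasurableSet hAB.symm).measurable_of_complete

/-- Claim `n` causes ruin for a surplus that pays dividends by `D`, but not for one that is ahead
by `h + δ T_n`. -/
def separatingClaim (x h δ : ℝ) (D : ℝ≥0 → Ω → ℝ) (n : ℕ) : Set Ω :=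
  {ω | M.claim n ω ∈ Ioc (M.surplusBefore x D n ω)
    (M.surplusBefore x D n ω + (h + δ * M.arrival n ω))}

variable {M}

lemma IsAdmissible.lintegral_separatingClaim_le [P.IsComplete] [IsProbabilityMeasure P]
    {cbar b q K : ℝ} {D : ℝ≥0 → Ω → ℝ} (hD : M.IsAdmissible cbar b D) (hK : 0 ≤ K)
    (hF : ∀ x y : ℝ, x < y → cdf M.claimLaw y - cdf M.claimLaw x ≤ K * (y - x))
    (hq : 0 < q) (x : ℝ) {h δ : ℝ} (hh : 0 ≤ h) (hδ : 0 ≤ δ) (n : ℕ) :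
    ∫⁻ ω, (M.separatingClaim x h δ D n).indicator
        (fun ω => ENNReal.ofReal (Real.exp (-q * M.arrival n ω))) ω ∂P
      ≤ ENNReal.ofReal (K * (h + 2 / q * δ))
        * ∫⁻ ω, ENNReal.ofReal (Real.exp (-(q / 2) * M.arrival n ω)) ∂P := by
  have hle := M.priorEvents_le n
  have hY := hD.measurable_surplusBefore x n
  have hT := M.measurable_arrival_priorEvents n n
  have hξ : Measurable[M.priorEvents n] fun ω => (M.arrival n ω, M.surplusBefore x D n ω) :=
    hT.prodMk hY
  have hξ' := hξ.mono hle le_rfl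
  have hU := M.measurable_claim n
  have hind := (indepFun_iff_map_prod_eq_prod_map_map hξ'.aemeasurable hU.aemeasurable).1
    (M.indepFun_claim_of_priorEvents hξ)
  rw [(M.hasLaw_claim n).map_eq] at hind
  have := M.claimLaw_isProbability
  let φ : (ℝ × ℝ) × ℝ → ℝ≥0∞ :=
    {z : (ℝ × ℝ) × ℝ | z.2 ∈ Ioc z.1.2 (z.1.2 + (h + δ * z.1.1))}.indicator
      (fun z => ENNReal.ofReal (Real.exp (-q * z.1.1)))
  have hset : MeasurableSet {z : (ℝ × ℝ) × ℝ | z.2 ∈ Ioc z.1.2 (z.1.2 + (h + δ * z.1.1))} :=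
    (measurableSet_lt (f := fun z : (ℝ × ℝ) × ℝ => z.1.2) (g := fun z => z.2) (by fun_prop)
      (by fun_prop)).inter (measurableSet_le (f := fun z : (ℝ × ℝ) × ℝ => z.2)
      (g := fun z => z.1.2 + (h + δ * z.1.1)) (by fun_prop) (by fun_prop))
  have hφm : Measurable φ := Measurable.indicator (by fun_prop) hset
  calc ∫⁻ ω, (M.separatingClaim x h δ D n).indicator
        (fun ω => ENNReal.ofReal (Real.exp (-q * M.arrival n ω))) ω ∂P
      = ∫⁻ ω, φ ((M.arrival n ω, M.surplusBefore x D n ω), M.claim n ω) ∂P := rfl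
    _ = ∫⁻ z, φ z ∂(P.map fun ω => ((M.arrival n ω, M.surplusBefore x D n ω), M.claim n ω)) :=
        (lintegral_map hφm (hξ'.prodMk hU)).symm
    _ = ∫⁻ y, ∫⁻ u, φ (y, u) ∂M.claimLaw
          ∂(P.map fun ω => (M.arrival n ω, M.surplusBefore x D n ω)) := by
        rw [hind, lintegral_prod _ hφm.aemeasurable]
    _ ≤ ∫⁻ y, ENNReal.ofReal (Real.exp (-q * y.1)) * ENNReal.ofReal (K * (h + δ * y.1))
          ∂(P.map fun ω => (M.arrival n ω, M.surplusBefore x D n ω)) := by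
        -- With arrival time and prior surplus fixed, the claim must fall in a fixed interval of
        -- length `h + δ T_n`, whose mass the Lipschitz condition bounds.
        refine lintegral_mono fun y => ?_
        have h1 : ∀ u, φ (y, u) = (Ioc y.2 (y.2 + (h + δ * y.1))).indicator
          (fun _ => ENNReal.ofReal (Real.exp (-q * y.1))) u := fun u => rfl
        simp_rw [h1]
        rw [lintegral_indicator_const measurableSet_Ioc]
        gcongr
        exact M.claimLaw_Ioc_le hF _ _
    _ = ∫⁻ ω, ENNReal.ofReal (Real.exp (-q * M.arrival n ω))
          * ENNReal.ofReal (K * (h + δ * M.arrival n ω)) ∂P :=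
        lintegral_map (f := fun y : ℝ × ℝ => ENNReal.ofReal (Real.exp (-q * y.1))
          * ENNReal.ofReal (K * (h + δ * y.1))) (by fun_prop) hξ'
    _ ≤ ∫⁻ ω, ENNReal.ofReal (K * (h + 2 / q * δ))
          * ENNReal.ofReal (Real.exp (-(q / 2) * M.arrival n ω)) ∂P := by
        refine lintegral_mono_ae ?_
        filter_upwards [M.ae_regular] with ω hω
        rw [← ENNReal.ofReal_mul (Real.exp_pos _).le, ← ENNReal.ofReal_mul (by positivity)]
        refine ENNReal.ofReal_le_ofReal ?_
        have := mul_le_mul_of_nonneg_left (mul_exp_neg_le hq hh hδ (hω.arrival_pos n).le) hK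
        linarith
    _ = _ := lintegral_const_mul _ (by have := M.measurable_arrival n; fun_prop)

/-- At time `T_n` the count is already `n + 1`, so claim `n` has been deducted and must be added
back. -/
lemma Regular.surplusBefore_eq {ω : Ω} (hω : M.Regular ω) (x : ℝ) (D : ℝ≥0 → Ω → ℝ) (n : ℕ) :
    M.surplusBefore x D n ω = M.controlledSurplus x D (M.arrival n ω).toNNReal ω
      + M.claim n ω := by
  have hT := (hω.arrival_pos n).le
  have hcount : M.claimCount (M.arrival n ω).toNNReal ω = n + 1 := by
    refine le_antisymm (hω.lt_arrival_iff.1 ?_) (hω.arrival_le_iff.1 ?_)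
    · rw [Real.coe_toNNReal _ hT]
      exact hω.strictMono_arrival n.lt_succ_self
    · rw [Real.coe_toNNReal _ hT]
  have hint : ∫ s in Ioi (0 : ℝ), {ω | s.toNNReal < M.arrival n ω}.indicator (D s.toNNReal) ω
      = ∫ s in (0 : ℝ)..(M.arrival n ω), D s.toNNReal ω := by
    rw [intervalIntegral.integral_of_le hT, integral_Ioc_eq_integral_Ioo, ← Ioi_inter_Iio,
      ← setIntegral_indicator measurableSet_Iio]
    refine setIntegral_congr_fun measurableSet_Ioi fun s hs => ?_
    simp only [indicator, mem_ofPred_eq, Real.coe_toNNReal s (le_of_lt hs), mem_Iio]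
  rw [surplusBefore, controlledSurplus, freeSurplus, hcount, hint, Finset.sum_range_succ,
    Real.coe_toNNReal _ hT]
  ring

end CramerLundberg

/-! ### Comparing a strategy with its capped version -/

namespace CramerLundberg

variable {Ω : Type*} [MeasurableSpace Ω] {P : Measure Ω} {M : CramerLundberg P}

lemma controlledSurplus_nonneg_of_lt_ruinTime {x : ℝ} {C : ℝ≥0 → Ω → ℝ} {ω : Ω} {t : ℝ≥0}
    (ht : t < M.ruinTime x C ω) : 0 ≤ M.controlledSurplus x C t ω := by
  by_contra hcon
  exact absurd (sInf_le (mem_image_of_mem _ (not_le.1 hcon)) : M.ruinTime x C ω ≤ t) (not_le.2 ht)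

lemma ruinTime_mono {x₁ x₂ : ℝ} (hx : x₁ ≤ x₂) (C : ℝ≥0 → Ω → ℝ) (ω : Ω) :
    M.ruinTime x₁ C ω ≤ M.ruinTime x₂ C ω := by
  refine sInf_le_sInf (image_mono fun t ht => ?_)
  refine lt_of_le_of_lt ?_ (show M.controlledSurplus x₂ C t ω < 0 from ht)
  rw [controlledSurplus, controlledSurplus, freeSurplus, freeSurplus]
  linarith

lemma integral_le_toReal_lintegral_ofReal {F : Ω → ℝ} (hF : Integrable F P) :
    ∫ ω, F ω ∂P ≤ (∫⁻ ω, ENNReal.ofReal (F ω) ∂P).toReal := by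
  rw [integral_eq_lintegral_pos_part_sub_lintegral_neg_part hF]
  exact sub_le_self _ ENNReal.toReal_nonneg

variable [P.IsComplete] {cbar a b : ℝ} {C : ℝ≥0 → Ω → ℝ}

/-- The strategy `C` is ahead of its capped version by what is left of the initial advantage. -/
lemma IsAdmissible.controlledSurplus_sub (hC : M.IsAdmissible cbar a C) (hbp : b ≤ M.premium)
    {x₁ x₂ : ℝ} (hx : x₁ < x₂) (t : ℝ≥0) (ω : Ω) :
    M.controlledSurplus x₂ C t ω - M.controlledSurplus x₁ (M.cappedStrategy (x₂ - x₁) b C) t ω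
      = max (rateGap (x₂ - x₁) b M.premium (fun s => C s.toNNReal ω) t) 0 := by
  have hmono := hC.monotone_toNNReal ω
  have hh := sub_pos.2 hx
  rw [← add_integral_cappedRate hbp hmono hh (NNReal.coe_nonneg t), intervalIntegral.integral_sub
    (intervalIntegrable_cappedRate hbp hmono hh le_rfl (NNReal.coe_nonneg t))
    hmono.intervalIntegrable]
  have : ∫ s in (0 : ℝ)..t, M.cappedStrategy (x₂ - x₁) b C s.toNNReal ω
      = ∫ s in (0 : ℝ)..t,
        cappedRate (x₂ - x₁) b M.premium (fun s => C s.toNNReal ω) s := by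
    refine intervalIntegral.integral_congr fun s hs => ?_
    rw [uIcc_of_le (NNReal.coe_nonneg t)] at hs
    simp only [CramerLundberg.cappedStrategy, Real.coe_toNNReal s hs.1]
  simp only [controlledSurplus, freeSurplus, this]
  change _ = x₂ - x₁ + (_ - ∫ s in (0 : ℝ)..t, C s.toNNReal ω)
  ring

/-- If the capped strategy is ruined while `C` is not, then a claim has separated them. -/
lemma IsAdmissible.exists_separatingClaim (hC : M.IsAdmissible cbar a C) (hab : a ≤ b)
    (hbp : b ≤ M.premium) {x₁ x₂ : ℝ} (hx₁ : 0 ≤ x₁) (hx : x₁ < x₂) {ω : Ω} (hω : M.Regular ω)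
    {t : ℝ≥0} (hneg : M.controlledSurplus x₁ (M.cappedStrategy (x₂ - x₁) b C) t ω < 0)
    (ht : t < M.ruinTime x₂ C ω) :
    ∃ n, M.arrival n ω ≤ t ∧
      ω ∈ M.separatingClaim x₁ (x₂ - x₁) (b - a) (M.cappedStrategy (x₂ - x₁) b C) n := by
  have hmono := hC.monotone_toNNReal ω
  have hh := sub_pos.2 hx
  set D := M.cappedStrategy (x₂ - x₁) b C with hD
  -- Without an advantage left the two surpluses coincide, and `C` would be ruined too.
  have hgap : 0 < rateGap (x₂ - x₁) b M.premium (fun s => C s.toNNReal ω) t := by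
    by_contra hcon
    have h1 := hC.controlledSurplus_sub hbp hx t ω
    rw [max_eq_right (not_lt.1 hcon), ← hD] at h1
    have h2 := controlledSurplus_nonneg_of_lt_ruinTime ht
    linarith
  have hDp : ∀ s : ℝ, 0 ≤ s → s ≤ t → D s.toNNReal ω ≤ M.premium := by
    intro s hs hst
    refine cappedRate_le_of_pos hbp ?_
    rw [Real.coe_toNNReal s hs]
    by_contra hcon
    exact absurd (rateGap_nonpos_of_le hbp hmono hh hs hst (not_lt.1 hcon)) (not_le.2 hgap)
  have hDmono : Monotone fun s : ℝ => D s.toNNReal ω := fun s u hsu =>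
    cappedRate_monotoneOn hbp hmono hh (NNReal.coe_nonneg _) (NNReal.coe_nonneg _)
      (NNReal.coe_le_coe.2 (Real.toNNReal_le_toNNReal hsu))
  have hint : ∀ s : ℝ, 0 ≤ s → s ≤ t →
      ∫ u in s..t, D u.toNNReal ω ≤ M.premium * (t - s) := by
    intro s hs hst
    have := intervalIntegral.integral_mono_on hst hDmono.intervalIntegrable
      (intervalIntegrable_const (μ := volume) (c := M.premium)) fun u hu =>
        hDp u (hs.trans hu.1) hu.2
    rw [intervalIntegral.integral_const, smul_eq_mul] at this
    linarith
  -- Paying at most `p` from `x₁ ≥ 0`, the surplus cannot become negative without a claim. The last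
  -- claim up to `t` has index `n`.
  obtain ⟨n, hn⟩ : ∃ n, M.claimCount t ω = n + 1 := by
    refine Nat.exists_eq_succ_of_ne_zero fun h0 => ?_
    rw [controlledSurplus, freeSurplus, h0, Finset.sum_range_zero] at hneg
    have := hint 0 le_rfl t.2
    linarith
  have hTt : M.arrival n ω ≤ t := hω.arrival_le_iff.2 (by omega)
  have hT := (hω.arrival_pos n).le
  have hcount : M.claimCount (M.arrival n ω).toNNReal ω = n + 1 := by
    refine le_antisymm ?_ (hω.arrival_le_iff.1 (Real.coe_toNNReal _ hT).ge)
    exact hn ▸ hω.claimCount_mono (Real.toNNReal_le_iff_le_coe.2 hTt)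
  -- After that last claim premiums cover dividends, so a surplus negative at `t` was already
  -- negative at `T_n`.
  have hlow : M.controlledSurplus x₁ D (M.arrival n ω).toNNReal ω < 0 := by
    refine lt_of_le_of_lt ?_ hneg
    rw [controlledSurplus, controlledSurplus, freeSurplus, freeSurplus, hcount, hn,
      Real.coe_toNNReal _ hT, ← intervalIntegral.integral_add_adjacent_intervals
        (a := 0) (b := M.arrival n ω) (c := t) hDmono.intervalIntegrable
        hDmono.intervalIntegrable]
    have := hint _ hT hTt
    linarith
  have hup : 0 ≤ M.controlledSurplus x₂ C (M.arrival n ω).toNNReal ω :=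
    controlledSurplus_nonneg_of_lt_ruinTime
      ((ENNReal.coe_le_coe.2 (Real.toNNReal_le_iff_le_coe.2 hTt)).trans_lt ht)
  refine ⟨n, hTt, ?_⟩
  have h1 := hC.controlledSurplus_sub hbp hx (M.arrival n ω).toNNReal ω
  have h2 := rateGap_le (h := x₂ - x₁) (p := M.premium) hab hmono (fun s => hC.lower _ ω) hT
  rw [← hD, Real.coe_toNNReal _ hT] at h1
  have h3 : max (rateGap (x₂ - x₁) b M.premium (fun s => C s.toNNReal ω) (M.arrival n ω)) 0
      ≤ x₂ - x₁ + (b - a) * M.arrival n ω :=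
    max_le h2 (add_nonneg hh.le (mul_nonneg (sub_nonneg.2 hab) hT))
  have h4 := hω.surplusBefore_eq x₁ D n
  constructor <;> linarith

/-- The present value lost by the capped strategy, scenario by scenario. -/
lemma IsAdmissible.presentValue_sub_le (hC : M.IsAdmissible cbar a C) (ha : 0 ≤ a) (hab : a ≤ b)
    (hb : b ≤ cbar) (hbp : b ≤ M.premium) {q : ℝ} (hq : 0 < q) {x₁ x₂ : ℝ} (hx₁ : 0 ≤ x₁)
    (hx : x₁ < x₂) {ω : Ω} (hω : M.Regular ω) :
    ENNReal.ofReal (presentValue q (fun s => C s.toNNReal ω) (M.ruinTime x₂ C ω)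
      - presentValue q (fun s => M.cappedStrategy (x₂ - x₁) b C s.toNNReal ω)
          (M.ruinTime x₁ (M.cappedStrategy (x₂ - x₁) b C) ω) - (x₂ - x₁))
    ≤ ∑' n, ENNReal.ofReal (cbar / q)
      * (M.separatingClaim x₁ (x₂ - x₁) (b - a) (M.cappedStrategy (x₂ - x₁) b C) n).indicator
        (fun ω => ENNReal.ofReal (Real.exp (-q * M.arrival n ω))) ω := by
  classical
  have hmono := hC.monotone_toNNReal ω
  have hh := sub_pos.2 hx
  have hDadm := hC.cappedStrategy hh hb hbp
  set D := M.cappedStrategy (x₂ - x₁) b C with hD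
  have hDmono := hDadm.monotone_toNNReal ω
  have hC0 : ∀ s : ℝ, 0 ≤ C s.toNNReal ω := fun s => ha.trans (hC.lower _ ω)
  have hCb : ∀ s : ℝ, C s.toNNReal ω ≤ cbar := fun s => hC.upper _ ω
  have hcb : 0 ≤ cbar := ha.trans (hab.trans hb)
  have hcomp : ∀ τ, presentValue q (fun s => C s.toNNReal ω) τ
      ≤ presentValue q (fun s => D s.toNNReal ω) τ + (x₂ - x₁) := by
    refine presentValue_le_add hq hmono hC0 hCb hDmono
      (fun s => (ha.trans hab).trans (hDadm.lower _ ω)) (fun s => hDadm.upper _ ω) fun θ hθ => ?_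
    refine le_trans (le_of_eq ?_) (integral_exp_mul_sub_cappedRate_le hbp hmono hh hq.le hθ)
    refine intervalIntegral.integral_congr fun s hs => ?_
    rw [uIcc_of_le hθ] at hs
    simp only [hD, CramerLundberg.cappedStrategy, Real.coe_toNNReal s hs.1]
  rcases le_or_gt (M.ruinTime x₂ C ω) (M.ruinTime x₁ D ω) with hle | hlt
  · rw [ENNReal.ofReal_of_nonpos]
    · exact zero_le
    · have := presentValue_mono hq hmono hC0 hCb hle
      have := hcomp (M.ruinTime x₁ D ω)
      linarith
  · obtain ⟨_, ⟨t, ht, rfl⟩, htτ⟩ := sInf_lt_iff.1 (show sInf _ < _ from hlt)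
    have hex : ∃ n, ω ∈ M.separatingClaim x₁ (x₂ - x₁) (b - a) D n :=
      (hC.exists_separatingClaim hab hbp hx₁ hx hω ht htτ).imp fun n hn => hn.2
    -- For the first separating claim, ruin of `D` cannot precede `T_n`: each negative time before
    -- the ruin of `C` follows a separating claim, and any later time exceeds the witness `t ≥ T_n`.
    set n := Nat.find hex
    have hTle : ∀ t : ℝ≥0, M.controlledSurplus x₁ D t ω < 0 → (t : ℝ≥0∞) < M.ruinTime x₂ C ω →
        ENNReal.ofReal (M.arrival n ω) ≤ t := by
      intro t ht htτ
      obtain ⟨m, hm, hm'⟩ := hC.exists_separatingClaim hab hbp hx₁ hx hω ht htτ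
      refine ENNReal.coe_le_coe.2 (Real.toNNReal_le_iff_le_coe.2 (le_trans ?_ hm))
      exact hω.strictMono_arrival.monotone (Nat.find_min' hex hm')
    have hTτ : ENNReal.ofReal (M.arrival n ω) ≤ M.ruinTime x₁ D ω := by
      refine le_sInf ?_
      rintro _ ⟨u, hu, rfl⟩
      rcases lt_or_ge (u : ℝ≥0∞) (M.ruinTime x₂ C ω) with h | h
      · exact hTle u hu h
      · exact (hTle t ht htτ).trans (htτ.le.trans h)
    have h1 := presentValue_le_add_exp hq hmono hC0 hCb (hω.arrival_pos n).le hTτ hlt.le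
    have h2 := hcomp (M.ruinTime x₁ D ω)
    refine le_trans ?_ (ENNReal.le_tsum n)
    rw [indicator_of_mem (Nat.find_spec hex), ← ENNReal.ofReal_mul (div_nonneg hcb hq.le)]
    exact ENNReal.ofReal_le_ofReal (by linarith)

lemma IsAdmissible.measurableSet_separatingClaim [IsProbabilityMeasure P]
    (hC : M.IsAdmissible cbar a C) (x h δ : ℝ) (n : ℕ) :
    MeasurableSet (M.separatingClaim x h δ C n) := by
  have hY := (hC.measurable_surplusBefore x n).mono (M.priorEvents_le n) le_rfl
  have hU := M.measurable_claim n
  have hT := M.measurable_arrival n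
  exact (measurableSet_lt hY hU).inter (measurableSet_le hU (by fun_prop))

/-- The value lost by the capped strategy. -/
lemma IsAdmissible.strategyValue_le [IsProbabilityMeasure P] (hC : M.IsAdmissible cbar a C)
    (ha : 0 ≤ a) (hab : a ≤ b) (hb : b ≤ cbar) (hbp : b ≤ M.premium) {q K : ℝ} (hq : 0 < q)
    (hK : 0 ≤ K) (hF : ∀ x y : ℝ, x < y → cdf M.claimLaw y - cdf M.claimLaw x ≤ K * (y - x))
    {x₁ x₂ : ℝ} (hx₁ : 0 ≤ x₁) (hx : x₁ < x₂) :
    M.strategyValue q x₂ C ≤ M.strategyValue q x₁ (M.cappedStrategy (x₂ - x₁) b C) + (x₂ - x₁)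
      + cbar / q * (K * (x₂ - x₁ + 2 / q * (b - a)) * M.arrivalSum (q / 2)) := by
  have hh := sub_pos.2 hx
  have hδ := sub_nonneg.2 hab
  have hcb : 0 ≤ cbar := ha.trans (hab.trans hb)
  have hDadm := hC.cappedStrategy hh hb hbp
  set D := M.cappedStrategy (x₂ - x₁) b C with hD
  have hi1 := hC.integrable_presentValue hq ha x₂
  have hi2 := hDadm.integrable_presentValue hq (ha.trans hab) x₁
  have h1 := integral_le_toReal_lintegral_ofReal ((hi1.sub hi2).sub (integrable_const (x₂ - x₁)))
  have h2 : ∫⁻ ω, ENNReal.ofReal (presentValue q (fun s => C s.toNNReal ω) (M.ruinTime x₂ C ω)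
      - presentValue q (fun s => D s.toNNReal ω) (M.ruinTime x₁ D ω) - (x₂ - x₁)) ∂P
      ≤ ENNReal.ofReal
        (cbar / q * (K * (x₂ - x₁ + 2 / q * (b - a)) * M.arrivalSum (q / 2))) := by
    have hmeas : ∀ n, Measurable fun ω =>
        (M.separatingClaim x₁ (x₂ - x₁) (b - a) D n).indicator
          (fun ω => ENNReal.ofReal (Real.exp (-q * M.arrival n ω))) ω := fun n =>
      Measurable.indicator (by have := M.measurable_arrival n; fun_prop)
        (hDadm.measurableSet_separatingClaim _ _ _ n)
    calc _ ≤ ∫⁻ ω, ∑' n, ENNReal.ofReal (cbar / q)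
          * (M.separatingClaim x₁ (x₂ - x₁) (b - a) D n).indicator
            (fun ω => ENNReal.ofReal (Real.exp (-q * M.arrival n ω))) ω ∂P := by
          refine lintegral_mono_ae ?_
          filter_upwards [M.ae_regular] with ω hω
            using hC.presentValue_sub_le ha hab hb hbp hq hx₁ hx hω
      _ = ∑' n, ENNReal.ofReal (cbar / q)
          * ∫⁻ ω, (M.separatingClaim x₁ (x₂ - x₁) (b - a) D n).indicator
            (fun ω => ENNReal.ofReal (Real.exp (-q * M.arrival n ω))) ω ∂P := by
          rw [lintegral_tsum fun n => ((hmeas n).const_mul _).aemeasurable]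
          simp_rw [lintegral_const_mul _ (hmeas _)]
      _ ≤ ∑' n, ENNReal.ofReal (cbar / q)
          * (ENNReal.ofReal (K * (x₂ - x₁ + 2 / q * (b - a)))
            * ∫⁻ ω, ENNReal.ofReal (Real.exp (-(q / 2) * M.arrival n ω)) ∂P) := by
          refine ENNReal.tsum_le_tsum fun n => ?_
          gcongr
          exact hDadm.lintegral_separatingClaim_le hK hF hq x₁ hh.le hδ n
      _ = _ := by
          rw [ENNReal.tsum_mul_left, ENNReal.tsum_mul_left,
            M.tsum_lintegral_exp_neg_arrival (half_pos hq), ← ENNReal.ofReal_mul (by positivity),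
            ← ENNReal.ofReal_mul (by positivity)]
  have h3 := h1.trans (ENNReal.toReal_mono ENNReal.ofReal_ne_top h2)
  have hS := M.arrivalSum_nonneg (q / 2)
  rw [ENNReal.toReal_ofReal (by positivity)] at h3
  have h4 := integral_sub (hi1.sub hi2) (integrable_const (x₂ - x₁))
  have h5 := integral_sub hi1 hi2
  simp only [Pi.sub_apply, integral_const, probReal_univ, smul_eq_mul, one_mul] at h3 h4 h5
  rw [strategyValue_eq, strategyValue_eq]
  linarith

/-! ### From strategies to the value function -/

variable (M) in
lemma value_mono [IsProbabilityMeasure P] {q : ℝ} (hq : 0 < q) (ha : 0 ≤ a) (hab : a ≤ b)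
    (hb : b ≤ cbar) {x₁ x₂ : ℝ} (hx : x₁ ≤ x₂) :
    M.value q cbar x₁ b ≤ M.value q cbar x₂ a := by
  refine csSup_le (M.nonempty_strategyValue hb x₁) ?_
  rintro _ ⟨C, hC : M.IsAdmissible cbar b C, rfl⟩
  have hC' : M.IsAdmissible cbar a C := { hC with lower := fun t ω => hab.trans (hC.lower t ω) }
  refine le_trans ?_ (le_csSup (M.bddAbove_strategyValue hq ha x₂) ⟨C, hC', rfl⟩)
  simp only [strategyValue_eq]
  refine integral_mono (hC'.integrable_presentValue hq ha x₁)
    (hC'.integrable_presentValue hq ha x₂) fun ω => ?_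
  exact presentValue_mono hq (hC.monotone_toNNReal ω) (fun s => ha.trans (hC'.lower _ ω))
    (fun s => hC.upper _ ω) (ruinTime_mono hx C ω)

variable (M) in
lemma value_le_add [IsProbabilityMeasure P] (ha : 0 ≤ a) (hab : a ≤ b) (hb : b ≤ cbar)
    (hbp : b ≤ M.premium) {q K : ℝ} (hq : 0 < q) (hK : 0 ≤ K)
    (hF : ∀ x y : ℝ, x < y → cdf M.claimLaw y - cdf M.claimLaw x ≤ K * (y - x))
    {x₁ x₂ : ℝ} (hx₁ : 0 ≤ x₁) (hx : x₁ ≤ x₂) :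
    M.value q cbar x₂ a ≤ M.value q cbar x₁ b + (x₂ - x₁)
      + cbar / q * (K * (x₂ - x₁ + 2 / q * (b - a)) * M.arrivalSum (q / 2)) := by
  have hlt : ∀ x, x₁ < x → M.value q cbar x a ≤ M.value q cbar x₁ b + (x - x₁)
      + cbar / q * (K * (x - x₁ + 2 / q * (b - a)) * M.arrivalSum (q / 2)) := by
    intro x hx
    refine csSup_le (M.nonempty_strategyValue (hab.trans hb) x) ?_
    rintro _ ⟨C, hC : M.IsAdmissible cbar a C, rfl⟩
    refine (hC.strategyValue_le ha hab hb hbp hq hK hF hx₁ hx).trans ?_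
    gcongr
    exact le_csSup (M.bddAbove_strategyValue hq (ha.trans hab) x₁)
      ⟨_, hC.cappedStrategy (sub_pos.2 hx) hb hbp, rfl⟩
  -- The construction needs a strictly positive initial advantage. For `x₁ = x₂`, compare with `x >
  -- x₂`, use monotonicity in the surplus, and let `x` decrease to `x₂`.
  have hlim : Tendsto (fun x => M.value q cbar x₁ b + (x - x₁)
      + cbar / q * (K * (x - x₁ + 2 / q * (b - a)) * M.arrivalSum (q / 2))) (𝓝[>] x₂)
      (𝓝 (M.value q cbar x₁ b + (x₂ - x₁)
      + cbar / q * (K * (x₂ - x₁ + 2 / q * (b - a)) * M.arrivalSum (q / 2)))) :=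
    (Continuous.tendsto (by fun_prop) x₂).mono_left nhdsWithin_le_nhds
  refine ge_of_tendsto hlim ?_
  filter_upwards [self_mem_nhdsWithin] with x (hx2 : x₂ < x)
  exact (M.value_mono hq ha le_rfl (hab.trans hb) hx2.le).trans (hlt x (hx.trans_lt hx2))

end CramerLundberg

theorem mainTheorem7 {Ω : Type*} [MeasurableSpace Ω] (P : Measure Ω) [IsProbabilityMeasure P]
    [P.IsComplete] (M : CramerLundberg P) (q cbar : ℝ) (hq : 0 < q) (hcbar : 0 < cbar)
    (hF : ∃ K : ℝ, 0 < K ∧ ∀ x y : ℝ, x < y →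
      0 ≤ cdf M.claimLaw y - cdf M.claimLaw x ∧
        cdf M.claimLaw y - cdf M.claimLaw x ≤ K * (y - x)) :
    (∃ K₁ : ℝ, 0 < K₁ ∧ ∀ x₁ x₂ c₁ c₂ : ℝ, 0 ≤ x₁ → x₁ ≤ x₂ → 0 ≤ c₁ → c₁ ≤ c₂ →
      c₂ ≤ min cbar M.premium →
        0 ≤ M.value q cbar x₂ c₁ - M.value q cbar x₁ c₂ ∧
        M.value q cbar x₂ c₁ - M.value q cbar x₁ c₂ ≤ K₁ * ((x₂ - x₁) + (c₂ - c₁))) ∧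
    ∃ L : ℝ≥0, LipschitzOnWith L (fun z : ℝ × ℝ => M.value q cbar z.1 z.2)
      (Ici 0 ×ˢ Icc 0 (min cbar M.premium)) := by
  obtain ⟨K, hK, hF⟩ := hF
  have hS := M.arrivalSum_nonneg (q / 2)
  have hmain : ∃ K₁ : ℝ, 0 < K₁ ∧ ∀ x₁ x₂ c₁ c₂ : ℝ, 0 ≤ x₁ → x₁ ≤ x₂ → 0 ≤ c₁ → c₁ ≤ c₂ →
      c₂ ≤ min cbar M.premium →
        0 ≤ M.value q cbar x₂ c₁ - M.value q cbar x₁ c₂ ∧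
        M.value q cbar x₂ c₁ - M.value q cbar x₁ c₂ ≤ K₁ * ((x₂ - x₁) + (c₂ - c₁)) := by
    -- The summand `1` pays for lost dividends, the rest for earlier ruin; `1 + 2 / q` dominates the
    -- coefficients of both increments.
    refine ⟨1 + cbar / q * (K * (1 + 2 / q) * M.arrivalSum (q / 2)), by positivity, ?_⟩
    intro x₁ x₂ c₁ c₂ hx₁ hx hc₁ hc hc₂
    have hcb := hc₂.trans (min_le_left _ _)
    have hcp := hc₂.trans (min_le_right _ _)
    refine ⟨sub_nonneg.2 (M.value_mono hq hc₁ hc hcb hx), ?_⟩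
    have h1 := M.value_le_add hc₁ hc hcb hcp hq hK.le (fun x y hxy => (hF x y hxy).2) hx₁ hx
    have hx' := sub_nonneg.2 hx
    have hc' := sub_nonneg.2 hc
    have h2 : x₂ - x₁ + 2 / q * (c₂ - c₁) ≤ (1 + 2 / q) * ((x₂ - x₁) + (c₂ - c₁)) := by
      have : 0 ≤ 2 / q * (x₂ - x₁) := by positivity
      linarith
    have h3 : cbar / q * (K * (x₂ - x₁ + 2 / q * (c₂ - c₁)) * M.arrivalSum (q / 2))
        ≤ cbar / q * (K * ((1 + 2 / q) * ((x₂ - x₁) + (c₂ - c₁))) * M.arrivalSum (q / 2)) := by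
      gcongr
    linarith
  refine ⟨hmain, ?_⟩
  obtain ⟨K₁, hK₁, h⟩ := hmain
  -- The factor `2` arises because each of the two increments is bounded by the sup distance on the
  -- product.
  refine ⟨(2 * K₁).toNNReal, LipschitzOnWith.of_le_add_mul _ ?_⟩
  rintro ⟨x, c⟩ ⟨hx, hc⟩ ⟨y, d⟩ ⟨hy, hd⟩
  simp only [mem_Ici, mem_Icc] at hx hc hy hd
  -- Pass through `(max x y, min c d)`: its value dominates that at `(x, c)` and exceeds that at
  -- `(y, d)` by a controlled amount.
  have h1 := (h x (max x y) (min c d) c hx (le_max_left _ _) (le_min hc.1 hd.1) (min_le_left _ _)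
    hc.2).1
  have h2 := (h y (max x y) (min c d) d hy (le_max_right _ _) (le_min hc.1 hd.1) (min_le_right _ _)
    hd.2).2
  have h3 : max x y - y ≤ dist (x, c) (y, d) := by
    rw [Prod.dist_eq]
    refine le_trans ?_ (le_max_left _ _)
    rw [Real.dist_eq, sub_le_iff_le_add]
    exact max_le (by linarith [le_abs_self (x - y)]) (by linarith [abs_nonneg (x - y)])
  have h4 : d - min c d ≤ dist (x, c) (y, d) := by
    rw [Prod.dist_eq]
    refine le_trans ?_ (le_max_right _ _)
    rw [Real.dist_eq, sub_le_comm]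
    exact le_min (by linarith [neg_abs_le (c - d)]) (by linarith [abs_nonneg (c - d)])
  rw [Real.coe_toNNReal _ (by positivity)]
  have h5 : K₁ * ((max x y - y) + (d - min c d))
      ≤ K₁ * (dist (x, c) (y, d) + dist (x, c) (y, d)) := by gcongr
  simp only
  linarith
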